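/- **Conventions.** A bipartite graph is a relational structure $(V,E,P)$ in which $E$ is an irreflexive symmetric binary relation on $V$, $P=(V_0\times V_0)\cup(V_1\times V_1)$ for some partition $V=V_0\mathbin{\dot\cup}V_1$ (a part may be empty), and no pair in $E$ lies in $P$. The countable universal bipartite graph $B$ is the Fraïssé limit of the class of finite bipartite graphs in this sense: the countable structure, unique up to isomorphism, whose finite induced substructures are, up to isomorphism, precisely the finite bipartite graphs, and in which every isomorphism between finite induced substructures extends to an automorphism. $\operatorname{End} B$ is the monoid of all maps from the vertex set of $B$ to itself that preserve both relations. The image of $f\in\operatorname{End}B$ is the structure $(Vf,Ef,Pf)$. $K_{1,1}$ is the bipartite graph with two vertices, lying in different parts and joined by an edge. In a monoid $M$, write $f\mathrel{\mathscr L}g$ if $Mf=Mg$, $f\mathrel{\mathscr R}g$ if $fM=gM$, $\mathscr H=\mathscr L\cap\mathscr R$ and $\mathscr D=\mathscr L\circ\mathscr R$. A $\mathscr D$-class is regular if it is the $\mathscr D$-class of an element $f$ with $fgf=f$ for some $g\in M$. A group $\mathscr H$-class is an $\mathscr H$-class that is a group under the multiplication of $M$. **Theorem.** Let $B$ be the countable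 universal bipartite graph. 1. Let $\Gamma$ be a countable (undirected, loopless) graph. Then there are exactly $2^{\aleph_0}$ regular $\mathscr D$-classes $D$ of $\operatorname{End}B$ such that $D$ contains a group $\mathscr H$-class and every group $\mathscr H$-class contained in $D$ is isomorphic to $\operatorname{Aut}\Gamma$. 2. Let $f$ be an idempotent endomorphism of $B$ whose image is not isomorphic to $K_{1,1}$. Then the $\mathscr D$-class of $f$ in $\operatorname{End}B$ contains exactly $2^{\aleph_0}$ group $\mathscr H$-classes. 3. There is a $\mathscr D$-class $D$ of $\operatorname{End}B$ such that the idempotents in $D$ are precisely the idempotent endomorphisms of $B$ whose image is isomorphic to $K_{1,1}$. This $D$ contains exactly $\aleph_0$ group $\mathscr H$-classes, each of which is isomorphic to the cyclic group of order $2$. -/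

import Mathlib

open FirstOrder

universe u v

/-! ### Green's relations in a monoid -/

section Green

variable {M : Type u} [Monoid M]

/-- `f` and `g` generate the same left ideal: `M f = M g`. -/
def GreenL (f g : M) : Prop := Set.range (fun m : M => m * f) = Set.range (fun m : M => m * g)

/-- `f` and `g` generate the same right ideal: `f M = g M`. -/
def GreenR (f g : M) : Prop := Set.range (fun m : M => f * m) = Set.range (fun m : M => g * m)

/-- The intersection of `GreenL` and `GreenR`. -/
def GreenH (f g : M) : Prop := GreenL f g ∧ GreenR f g

/-- The composite of `GreenL` and `GreenR`. -/
def GreenD (f g : M) : Prop := ∃ h : M, GreenL f h ∧ GreenR h g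

/-- The `H`-class of `f`. -/
def hClass (f : M) : Set M := {g | GreenH f g}

/-- The `D`-class of `f`. -/
def dClass (f : M) : Set M := {g | GreenD f g}

/-- `D` is one of the `D`-classes of the monoid. -/
def IsDClass (D : Set M) : Prop := ∃ f : M, D = dClass f

/-- `f` is a regular element: `f g f = f` for some `g`. -/
def IsRegularElement (f : M) : Prop := ∃ g : M, f * g * f = f

/-- `D` is the `D`-class of a regular element. -/
def IsRegularDClass (D : Set M) : Prop := ∃ f : M, IsRegularElement f ∧ D = dClass f

/-- The subset `H` is a group under the multiplication of the monoid; its identity element need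
not be that of the monoid. -/
def IsGroupUnderMul (H : Set M) : Prop :=
  (∀ a ∈ H, ∀ b ∈ H, a * b ∈ H) ∧
    ∃ e ∈ H, ∀ a ∈ H, e * a = a ∧ a * e = a ∧ ∃ b ∈ H, a * b = e ∧ b * a = e

/-- `H` is a group `H`-class: an `H`-class that is a group under the multiplication of the
monoid. -/
def IsGroupHClass (H : Set M) : Prop := (∃ f : M, H = hClass f) ∧ IsGroupUnderMul H

/-- The subset `H`, with the multiplication of the monoid, is isomorphic to the group `G`: there is
a multiplicative bijection from `G` onto `H`. -/
def IsIsoToGroup (H : Set M) (G : Type v) [Group G] : Prop :=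
  ∃ φ : G →ₙ* M, Function.Injective φ ∧ Set.range φ = H

end Green

/-! ### Bipartite graphs as relational structures -/

/-- The relation symbols of bipartite graphs: the binary edge relation and the binary partition
relation. -/
inductive BipRel : ℕ → Type
  | edge : BipRel 2
  | part : BipRel 2

/-- The relational signature of bipartite graphs `(V, E, P)`. -/
def bipLang : Language := ⟨fun _ => Empty, BipRel⟩

instance bipLang_isRelational : bipLang.IsRelational := fun _ => inferInstanceAs (IsEmpty Empty)

section Bipartite

variable {V : Type u} [bipLang.Structure V]

/-- The edge relation `E`. -/
def BipEdge (x y : V) : Prop :=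
  Language.Structure.RelMap (L := bipLang) (M := V) BipRel.edge ![x, y]

/-- The partition relation `P`. -/
def BipPart (x y : V) : Prop :=
  Language.Structure.RelMap (L := bipLang) (M := V) BipRel.part ![x, y]

variable (V) in
/-- `(V, E, P)` is a bipartite graph: `E` is irreflexive and symmetric,
`P = (V₀ × V₀) ∪ (V₁ × V₁)` for a partition of `V` into two parts `V₀`, `V₁` (one of which may be
empty), and no edge lies in `P`. -/
structure IsBipartiteGraph : Prop where
  irrefl : ∀ x : V, ¬ BipEdge x x
  symm : ∀ x y : V, BipEdge x y → BipEdge y x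
  partition : ∃ V₀ V₁ : Set V, V₀ ∪ V₁ = Set.univ ∧ Disjoint V₀ V₁ ∧
    ∀ x y : V, BipPart x y ↔ (x ∈ V₀ ∧ y ∈ V₀) ∨ (x ∈ V₁ ∧ y ∈ V₁)
  edge_not_part : ∀ x y : V, BipEdge x y → ¬ BipPart x y

end Bipartite

/-- The class of finite bipartite graphs. As the age of a relational structure in Mathlib contains
the empty structure, so does this class; that does not affect its Fraïssé limit. -/
def finiteBipartiteGraphs : Set (CategoryTheory.Bundled.{u} bipLang.Structure) :=
  {G | Finite G ∧ IsBipartiteGraph G}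

/-- `V` is (a copy of) the countable universal bipartite graph, the Fraïssé limit of the class of
finite bipartite graphs. -/
def IsCountableUniversalBipartiteGraph (V : Type u) [bipLang.Structure V] [Countable V] : Prop :=
  Language.IsFraisseLimit (L := bipLang) finiteBipartiteGraphs V

/-- The monoid of endomorphisms of `V`, that is, of the maps `V → V` that preserve the edge relation
and the partition relation. -/
abbrev BipEnd (V : Type u) [bipLang.Structure V] : Type u := V →[bipLang] V

/-- Maps are written on the right: `f * g` is `f` followed by `g`. -/
instance BipEnd.instMonoid (V : Type u) [bipLang.Structure V] : Monoid (BipEnd V) where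
  mul f g := Language.Hom.comp g f
  one := Language.Hom.id bipLang V
  mul_assoc _ _ _ := rfl
  one_mul _ := rfl
  mul_one _ := rfl

/-- The vertex set `V f` of the image of an endomorphism. -/
abbrev BipImage {V : Type u} [bipLang.Structure V] (f : BipEnd V) : Type u := Set.range f

/-- The image `(V f, E f, P f)` of an endomorphism of `(V, E, P)`: its relations are the images of
the relations `E` and `P` under `f`. -/
instance BipImage.instStructure {V : Type u} [bipLang.Structure V] (f : BipEnd V) :
    bipLang.Structure (BipImage f) where
  funMap := fun c => Empty.elim c
  RelMap := fun {n} r x => ∃ y : Fin n → V,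
    Language.Structure.RelMap r y ∧ ∀ i, f (y i) = (x i : V)

/-- The vertex set of the complete bipartite graph on the parts `α` and `β`. -/
abbrev CompleteBip (α β : Type) : Type := α ⊕ β

/-- The complete bipartite graph on the parts `α` and `β`: vertices are joined by an edge when they
lie in different parts, and related by the partition relation when they lie in the same part. -/
instance CompleteBip.instStructure (α β : Type) : bipLang.Structure (CompleteBip α β) where
  funMap := fun c => Empty.elim c
  RelMap
    | BipRel.edge => fun x => Sum.isLeft (x 0) ≠ Sum.isLeft (x 1)
    | BipRel.part => fun x => Sum.isLeft (x 0) = Sum.isLeft (x 1)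

/-- The image of the endomorphism `f` is isomorphic to `K_{1,1}`. -/
def ImageIsoK11 {V : Type u} [bipLang.Structure V] (f : BipEnd V) : Prop :=
  Nonempty (BipImage f ≃[bipLang] CompleteBip Unit Unit)

-- An idempotent of `BipEnd V` is a retraction onto a graph `X` followed by a section
-- (`SplitsThrough`). The idempotents in its D-class are exactly those that split through `X`
-- (`SplitsThrough.mem_dClass_iff`), the group H-classes in that D-class correspond to these
-- idempotents (`groupHClassEquiv`), and each such H-class is a copy of Aut `X`
-- (`SplitsThrough.isIsoToGroup`). Everything thus reduces to finding the retracts of the universal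
-- graph and counting the retractions onto each.
--
-- The retracts are the countable bipartite graphs in which every finite subset of one part has a
-- common neighbour in the other. Necessity: take a common neighbour upstairs and push it down
-- (`SplitsThrough.hasCommonNeighbours`). Sufficiency: such an `X` is a retract of a generic cover
-- that has the extension property (`hasExtension_cover`), and back-and-forth identifies this cover
-- with the universal graph (`exists_retract`).
--
-- For the first claim, a graph `Γ` and a set `A` of natural numbers are encoded in a retract
-- `CodingGraph Γ A` whose automorphisms are those of `Γ` and from which `A` can be read off. For
-- the second, a retract other than an edge has two vertices in one part; infinitely many added
-- vertices can each be folded onto either of the two, independently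
-- (`continuum_le_mk_splitsThrough`). For the third, a retraction onto an edge is determined by an
-- ordered pair of vertices, and there are infinitely many edges (`mk_splitsThrough_completeBip`).

universe w

/-! ### Green's relations and idempotents -/

section Green

variable {M : Type u} [Monoid M]

theorem greenL_iff {f g : M} : GreenL f g ↔ (∃ a, f = a * g) ∧ ∃ b, g = b * f := by
  constructor
  · intro h
    have hf : f ∈ Set.range (fun m : M => m * g) := h ▸ ⟨1, one_mul f⟩
    have hg : g ∈ Set.range (fun m : M => m * f) := h.symm ▸ ⟨1, one_mul g⟩
    obtain ⟨a, ha⟩ := hf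
    obtain ⟨b, hb⟩ := hg
    exact ⟨⟨a, ha.symm⟩, b, hb.symm⟩
  · rintro ⟨⟨a, ha⟩, b, hb⟩
    apply Set.Subset.antisymm
    · rintro _ ⟨m, rfl⟩
      exact ⟨m * a, by simp only [mul_assoc, ← ha]⟩
    · rintro _ ⟨m, rfl⟩
      exact ⟨m * b, by simp only [mul_assoc, ← hb]⟩

theorem greenR_iff {f g : M} : GreenR f g ↔ (∃ a, f = g * a) ∧ ∃ b, g = f * b := by
  constructor
  · intro h
    have hf : f ∈ Set.range (fun m : M => g * m) := h ▸ ⟨1, mul_one f⟩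
    have hg : g ∈ Set.range (fun m : M => f * m) := h.symm ▸ ⟨1, mul_one g⟩
    obtain ⟨a, ha⟩ := hf
    obtain ⟨b, hb⟩ := hg
    exact ⟨⟨a, ha.symm⟩, b, hb.symm⟩
  · rintro ⟨⟨a, ha⟩, b, hb⟩
    apply Set.Subset.antisymm
    · rintro _ ⟨m, rfl⟩
      exact ⟨a * m, by simp only [← mul_assoc, ← ha]⟩
    · rintro _ ⟨m, rfl⟩
      exact ⟨b * m, by simp only [← mul_assoc, ← hb]⟩

theorem GreenL.refl (f : M) : GreenL f f := rfl

theorem GreenR.refl (f : M) : GreenR f f := rfl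

theorem mem_hClass_self (f : M) : f ∈ hClass f := ⟨.refl f, .refl f⟩

theorem mem_dClass_self (f : M) : f ∈ dClass f := ⟨f, .refl f, .refl f⟩

theorem hClass_eq_of_mem {f g : M} (h : g ∈ hClass f) : hClass g = hClass f := by
  obtain ⟨hL, hR⟩ : GreenH f g := h
  ext k
  exact ⟨fun ⟨h1, h2⟩ => ⟨hL.trans h1, hR.trans h2⟩,
    fun ⟨h1, h2⟩ => ⟨hL.symm.trans h1, hR.symm.trans h2⟩⟩

theorem hClass_subset_dClass {d e : M} : hClass e ⊆ dClass d ↔ e ∈ dClass d := by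
  refine ⟨fun h => h (mem_hClass_self e), ?_⟩
  rintro ⟨h, hL, hR⟩ g ⟨-, hg⟩
  exact ⟨h, hL, hR.trans hg⟩

/-- The `H`-class of an idempotent `e` is the group of units of the monoid `e M e`. -/
theorem mem_hClass_idempotent {e g : M} (he : IsIdempotentElem e) :
    g ∈ hClass e ↔
      e * g = g ∧ g * e = g ∧ ∃ w, e * w = w ∧ w * e = w ∧ g * w = e ∧ w * g = e := by
  have he' : e * e = e := he
  constructor
  · rintro ⟨hL, hR⟩
    obtain ⟨⟨a, ha⟩, b, hb⟩ := greenL_iff.1 hL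
    obtain ⟨⟨c, hc⟩, d, hd⟩ := greenR_iff.1 hR
    have h1 : e * g = g := by rw [hd, ← mul_assoc, he']
    have h2 : g * e = g := by rw [hb, mul_assoc, he']
    have h3 : g * (e * c * e) = e := by
      rw [← mul_assoc, ← mul_assoc, h2, ← hc, he']
    have h4 : (e * a * e) * g = e := by
      rw [mul_assoc, h1, mul_assoc, ← ha, he']
    -- A left inverse and a right inverse relative to the identity `e` agree.
    have h5 : e * a * e = e * c * e := by
      calc e * a * e = e * a * e * (g * (e * c * e)) := by rw [h3, mul_assoc (e * a), he']
        _ = e * (e * c * e) := by rw [← mul_assoc, h4]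
        _ = e * c * e := by simp only [← mul_assoc, he']
    refine ⟨h1, h2, e * c * e, ?_, ?_, h3, h5 ▸ h4⟩
    · simp only [← mul_assoc, he']
    · simp only [mul_assoc, he']
  · rintro ⟨h1, h2, w, -, -, h5, h6⟩
    exact ⟨greenL_iff.2 ⟨⟨w, h6.symm⟩, g, h2.symm⟩, greenR_iff.2 ⟨⟨w, h5.symm⟩, g, h1.symm⟩⟩

theorem isGroupHClass_hClass {e : M} (he : IsIdempotentElem e) : IsGroupHClass (hClass e) := by
  refine ⟨⟨e, rfl⟩, ?_, e, mem_hClass_self e, ?_⟩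
  · intro a ha b hb
    rw [mem_hClass_idempotent he] at *
    obtain ⟨a1, a2, w, w1, w2, w3, w4⟩ := ha
    obtain ⟨b1, b2, x, x1, x2, x3, x4⟩ := hb
    refine ⟨by rw [← mul_assoc, a1], by rw [mul_assoc, b2], x * w, by rw [← mul_assoc, x1],
      by rw [mul_assoc, w2], ?_, ?_⟩
    · rw [mul_assoc, ← mul_assoc b, x3, w1, w3]
    · rw [mul_assoc, ← mul_assoc w, w4, b1, x4]
  · intro a ha
    obtain ⟨a1, a2, w, w1, w2, w3, w4⟩ := (mem_hClass_idempotent he).1 ha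
    exact ⟨a1, a2, w, (mem_hClass_idempotent he).2 ⟨w1, w2, a, a1, a2, w4, w3⟩, w3, w4⟩

theorem IsGroupHClass.exists_idempotent {H : Set M} (hH : IsGroupHClass H) :
    ∃ e, IsIdempotentElem e ∧ H = hClass e := by
  obtain ⟨⟨f, rfl⟩, -, e, he, h⟩ := hH
  exact ⟨e, (h e he).1, (hClass_eq_of_mem he).symm⟩

/-- In the group with identity `e` the only idempotent is `e`: cancel `f` from `f * f = f`. -/
theorem eq_of_hClass_eq {e f : M} (he : IsIdempotentElem e) (hf : IsIdempotentElem f)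
    (h : hClass e = hClass f) : e = f := by
  obtain ⟨h1, h2, w, w1, w2, w3, w4⟩ :=
    (mem_hClass_idempotent he).1 (h.symm.subset (mem_hClass_self f))
  calc e = f * w := w3.symm
    _ = f * (f * w) := by rw [← mul_assoc, hf.eq]
    _ = f := by rw [w3, h2]

/-- The group `H`-classes in a `D`-class correspond to the idempotents in it. -/
noncomputable def groupHClassEquiv (d : M) :
    {e : M // IsIdempotentElem e ∧ e ∈ dClass d} ≃
      {H : Set M // IsGroupHClass H ∧ H ⊆ dClass d} :=
  Equiv.ofBijective
    (fun e => ⟨hClass e.1, isGroupHClass_hClass e.2.1, hClass_subset_dClass.2 e.2.2⟩) <| by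
      constructor
      · rintro ⟨e, he, _⟩ ⟨f, hf, _⟩ h
        exact Subtype.ext (eq_of_hClass_eq he hf (congrArg Subtype.val h))
      · rintro ⟨H, hH, hd⟩
        obtain ⟨e, he, rfl⟩ := hH.exists_idempotent
        exact ⟨⟨e, he, hClass_subset_dClass.1 hd⟩, rfl⟩

/-- An `h` that is L-related to `e` and R-related to `f` acts as an isomorphism between the two
idempotents, with inverse built from the witnesses of the relations. Conversely, `b * a * b` is such
an intermediate element. -/
theorem IsIdempotentElem.greenD_iff {e f : M} (he : IsIdempotentElem e)
    (hf : IsIdempotentElem f) : GreenD e f ↔ ∃ a b, a * b = e ∧ b * a = f := by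
  have he' : e * e = e := he
  have hf' : f * f = f := hf
  constructor
  · rintro ⟨h, hL, hR⟩
    obtain ⟨⟨c, hc⟩, d, hd⟩ := greenL_iff.1 hL
    obtain ⟨⟨p, hp⟩, q, hq⟩ := greenR_iff.1 hR
    have h1 : h * e = h := by rw [hd, mul_assoc, he']
    have h2 : f * h = h := by rw [hp, ← mul_assoc, hf']
    refine ⟨e * q, h, ?_, ?_⟩
    · rw [hc, mul_assoc c, ← hq, mul_assoc, h2]
    · rw [← mul_assoc, h1, hq]
  · rintro ⟨a, b, rfl, rfl⟩
    refine ⟨b * a * b, greenL_iff.2 ⟨⟨a, ?_⟩, b, ?_⟩, greenR_iff.2 ⟨⟨b, rfl⟩, a, ?_⟩⟩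
    · simpa only [mul_assoc] using he'.symm
    · simp only [mul_assoc]
    · simpa only [mul_assoc] using hf'.symm

end Green

/-! ### Bipartite graphs given by an adjacency relation and a side function -/

/-- The type `V`, regarded as the structure with the edge relation `E` whose partition relation is
the kernel of `p`. -/
def BipOf {V : Type u} (_E : V → V → Prop) (_p : V → Bool) : Type u := V

instance BipOf.instStructure {V : Type u} (E : V → V → Prop) (p : V → Bool) :
    bipLang.Structure (BipOf E p) where
  funMap := fun c => Empty.elim c
  RelMap
    | BipRel.edge => fun x => E (x 0) (x 1)
    | BipRel.part => fun x => p (x 0) = p (x 1)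

section

variable {V : Type u} {X : Type v} {Y : Type w}
  [bipLang.Structure V] [bipLang.Structure X] [bipLang.Structure Y]

theorem relMap_edge {x : Fin 2 → X} :
    Language.Structure.RelMap (L := bipLang) (M := X) BipRel.edge x ↔ BipEdge (x 0) (x 1) :=
  iff_of_eq (congrArg _ (funext fun i => by fin_cases i <;> rfl))

theorem BipHom.edge (f : X →[bipLang] Y) {x y : X} (h : BipEdge x y) : BipEdge (f x) (f y) :=
  relMap_edge.1 (f.map_rel BipRel.edge _ h)

theorem relMap_part {x : Fin 2 → X} :
    Language.Structure.RelMap (L := bipLang) (M := X) BipRel.part x ↔ BipPart (x 0) (x 1) :=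
  iff_of_eq (congrArg _ (funext fun i => by fin_cases i <;> rfl))

theorem BipHom.part (f : X →[bipLang] Y) {x y : X} (h : BipPart x y) : BipPart (f x) (f y) :=
  relMap_part.1 (f.map_rel BipRel.part _ h)

/-- A map that preserves both relations, as a homomorphism. -/
def BipHom.mk (f : X → Y) (hE : ∀ x y, BipEdge x y → BipEdge (f x) (f y))
    (hP : ∀ x y, BipPart x y → BipPart (f x) (f y)) : X →[bipLang] Y where
  toFun := f
  map_fun' := fun c => Empty.elim c
  map_rel' := by
    rintro n (_ | _) x h
    · exact relMap_edge.2 (hE _ _ (relMap_edge.1 h))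
    · exact relMap_part.2 (hP _ _ (relMap_part.1 h))

/-- An injective map that preserves and reflects both relations, as an embedding. -/
def BipEmb.mk (f : X → Y) (hf : Function.Injective f)
    (hE : ∀ x y, BipEdge (f x) (f y) ↔ BipEdge x y)
    (hP : ∀ x y, BipPart (f x) (f y) ↔ BipPart x y) : X ↪[bipLang] Y where
  toFun := f
  inj' := hf
  map_fun' := fun c => Empty.elim c
  map_rel' := by
    rintro n (_ | _) x
    · exact relMap_edge.trans ((hE _ _).trans relMap_edge.symm)
    · exact relMap_part.trans ((hP _ _).trans relMap_part.symm)

/-- A bijection that preserves both relations in both directions, as an isomorphism. -/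
def BipEquiv.mk (f : X ≃ Y) (hE : ∀ x y, BipEdge (f x) (f y) ↔ BipEdge x y)
    (hP : ∀ x y, BipPart (f x) (f y) ↔ BipPart x y) : X ≃[bipLang] Y where
  toEquiv := f
  map_fun' := fun c => Empty.elim c
  map_rel' := (BipEmb.mk f f.injective hE hP).map_rel'

theorem BipEmb.edge_iff (f : X ↪[bipLang] Y) {x y : X} :
    BipEdge (f x) (f y) ↔ BipEdge x y := by
  refine Iff.trans ?_ (f.map_rel BipRel.edge ![x, y])
  rw [relMap_edge]; rfl

theorem BipEmb.part_iff (f : X ↪[bipLang] Y) {x y : X} :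
    BipPart (f x) (f y) ↔ BipPart x y := by
  refine Iff.trans ?_ (f.map_rel BipRel.part ![x, y])
  rw [relMap_part]; rfl

theorem BipEquiv.edge_iff (f : X ≃[bipLang] Y) {x y : X} :
    BipEdge (f x) (f y) ↔ BipEdge x y := BipEmb.edge_iff f.toEmbedding

theorem BipEquiv.part_iff (f : X ≃[bipLang] Y) {x y : X} :
    BipPart (f x) (f y) ↔ BipPart x y := BipEmb.part_iff f.toEmbedding

/-! ### Idempotent endomorphisms as retractions -/

/-- The endomorphism `e` of `V` factors as a retraction onto `X` followed by a section. -/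
def SplitsThrough (e : BipEnd V) (X : Type v) [bipLang.Structure X] : Prop :=
  ∃ (i : X →[bipLang] V) (r : V →[bipLang] X), (∀ x, r (i x) = x) ∧ ∀ v, i (r v) = e v

theorem BipEnd.mul_apply (f g : BipEnd V) (v : V) : (f * g) v = g (f v) := rfl

theorem BipEnd.isIdempotentElem_iff {e : BipEnd V} :
    IsIdempotentElem e ↔ ∀ v, e (e v) = e v :=
  ⟨fun h v => DFunLike.congr_fun h v, fun h => DFunLike.ext _ _ h⟩

theorem SplitsThrough.isIdempotentElem {e : BipEnd V} (h : SplitsThrough e X) :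
    IsIdempotentElem e := by
  obtain ⟨i, r, h1, h2⟩ := h
  exact BipEnd.isIdempotentElem_iff.2 fun v => by rw [← h2, ← h2, h1]

/-- The corestriction preserves the image relations by their definition, and the inclusion preserves
them because `e` is a homomorphism. -/
theorem IsIdempotentElem.splitsThrough_image {e : BipEnd V} (he : IsIdempotentElem e) :
    SplitsThrough e (BipImage e) := by
  rw [BipEnd.isIdempotentElem_iff] at he
  refine ⟨⟨Subtype.val, fun c => Empty.elim c, ?_⟩,
    ⟨fun v => ⟨e v, v, rfl⟩, fun c => Empty.elim c, ?_⟩, ?_, fun v => rfl⟩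
  · rintro n R x ⟨y, hy, hx⟩
    have := e.map_rel R y hy
    convert this using 1
    exact funext fun i => (hx i).symm
  · intro n R y hy
    exact ⟨y, hy, fun i => rfl⟩
  · rintro ⟨_, v, rfl⟩
    exact Subtype.ext (he v)

theorem SplitsThrough.congr {e : BipEnd V} (h : SplitsThrough e X) (φ : X ≃[bipLang] Y) :
    SplitsThrough e Y := by
  obtain ⟨i, r, h1, h2⟩ := h
  exact ⟨i.comp φ.symm.toHom, φ.toHom.comp r, fun x => by simp [h1], fun v => by simp [h2]⟩

/-- Mutually inverse homomorphisms form an isomorphism. -/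
def BipEquiv.ofHoms (f : X →[bipLang] Y) (g : Y →[bipLang] X) (hgf : ∀ x, g (f x) = x)
    (hfg : ∀ y, f (g y) = y) : X ≃[bipLang] Y :=
  BipEquiv.mk ⟨f, g, hgf, hfg⟩
    (fun x y => ⟨fun h => by simpa [hgf] using BipHom.edge g h, BipHom.edge f⟩)
    (fun x y => ⟨fun h => by simpa [hgf] using BipHom.part g h, BipHom.part f⟩)

@[simp] theorem BipEquiv.ofHoms_apply (f : X →[bipLang] Y) (g hgf hfg) (x : X) :
    BipEquiv.ofHoms f g hgf hfg x = f x := rfl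

theorem SplitsThrough.nonempty_equiv {e : BipEnd V} (hX : SplitsThrough e X)
    (hY : SplitsThrough e Y) : Nonempty (X ≃[bipLang] Y) := by
  obtain ⟨i, r, h1, h2⟩ := hX
  obtain ⟨j, s, h3, h4⟩ := hY
  refine ⟨BipEquiv.ofHoms (s.comp i) (r.comp j) (fun x => ?_) (fun y => ?_)⟩
  · simp only [Language.Hom.comp_apply, h4, ← h2, h1]
  · simp only [Language.Hom.comp_apply, h2, ← h4, h3]

/-- If an idempotent splits through `X`, the idempotents in its `D`-class are those that split
through `X`. -/
theorem SplitsThrough.mem_dClass_iff {e f : BipEnd V} (he : SplitsThrough e X)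
    (hf : IsIdempotentElem f) : f ∈ dClass e ↔ SplitsThrough f X := by
  constructor
  · intro h
    obtain ⟨a, b, hab, hba⟩ := (he.isIdempotentElem.greenD_iff hf).1 h
    obtain ⟨i, r, h1, h2⟩ := he
    have hab' : ∀ v, b (a v) = i (r v) := fun v => by rw [h2, ← hab]; rfl
    have hba' : ∀ v, a (b v) = f v := fun v => by rw [← hba]; rfl
    refine ⟨a.comp i, r.comp b, fun x => ?_, fun v => ?_⟩
    · simp only [Language.Hom.comp_apply, hab', h1]
    · simp only [Language.Hom.comp_apply, ← hab', hba']
      exact BipEnd.isIdempotentElem_iff.1 hf v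
  · intro h
    refine (he.isIdempotentElem.greenD_iff hf).2 ?_
    obtain ⟨i, r, h1, h2⟩ := he
    obtain ⟨j, s, h3, h4⟩ := h
    refine ⟨j.comp r, i.comp s, DFunLike.ext _ _ fun v => ?_, DFunLike.ext _ _ fun v => ?_⟩
    · simp only [BipEnd.mul_apply, Language.Hom.comp_apply, h3, h2]
    · simp only [BipEnd.mul_apply, Language.Hom.comp_apply, h1, h4]

/-- The `H`-class of an idempotent that splits through `X` is the automorphism group of `X`. -/
theorem SplitsThrough.isIsoToGroup {e : BipEnd V} (he : SplitsThrough e X)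
    {G : Type w} [Group G] (ψ : G → (X ≃[bipLang] X)) (hψ : Function.Bijective ψ)
    (hmul : ∀ g h x, ψ (g * h) x = ψ g (ψ h x)) : IsIsoToGroup (hClass e) G := by
  have hid := he.isIdempotentElem
  obtain ⟨i, r, h1, h2⟩ := he
  have hone : ∀ x, ψ 1 x = x := fun x => (ψ 1).injective (by rw [← hmul, one_mul])
  -- The product of `BipEnd V` composes from left to right while `ψ` composes from right to left;
  -- the inverse makes `F` multiplicative.
  let F : G → BipEnd V := fun g => (i.comp (ψ g⁻¹).toHom).comp r
  have hF : ∀ g v, F g v = i (ψ g⁻¹ (r v)) := fun g v => rfl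
  have hFmul : ∀ g h, F (g * h) = F g * F h := fun g h => DFunLike.ext _ _ fun v => by
    rw [BipEnd.mul_apply, hF, hF, hF, h1, mul_inv_rev, hmul]
  have hFone : F 1 = e := DFunLike.ext _ _ fun v => by rw [hF, inv_one, hone, h2]
  refine ⟨⟨F, hFmul⟩, ?_, ?_⟩
  · intro g h hgh
    have hgh' : F g = F h := hgh
    have : ψ g⁻¹ = ψ h⁻¹ := DFunLike.ext _ _ fun x => by
      have := congrArg r (DFunLike.congr_fun hgh' (i x))
      simpa only [hF, h1] using this
    exact inv_injective (hψ.1 this)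
  · ext g
    constructor
    · rintro ⟨g, rfl⟩
      change F g ∈ _
      rw [mem_hClass_idempotent hid, ← hFone]
      simp only [← hFmul, one_mul, mul_one, true_and]
      exact ⟨F g⁻¹, by simp [← hFmul]⟩
    · intro hg
      obtain ⟨g1, g2, w, w1, w2, w3, w4⟩ := (mem_hClass_idempotent hid).1 hg
      have a1 : ∀ v, g (i (r v)) = g v := fun v => by
        rw [h2]; exact DFunLike.congr_fun g1 v
      have a2 : ∀ v, i (r (g v)) = g v := fun v => by
        rw [h2]; exact DFunLike.congr_fun g2 v
      have a3 : ∀ v, i (r (w v)) = w v := fun v => by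
        rw [h2]; exact DFunLike.congr_fun w2 v
      have a4 : ∀ v, w (g v) = i (r v) := fun v => by
        rw [h2]; exact DFunLike.congr_fun w3 v
      have a5 : ∀ v, g (w v) = i (r v) := fun v => by
        rw [h2]; exact DFunLike.congr_fun w4 v
      let φ : X ≃[bipLang] X := BipEquiv.ofHoms ((r.comp g).comp i) ((r.comp w).comp i)
        (fun x => by simp only [Language.Hom.comp_apply, a2, a4, h1])
        (fun x => by simp only [Language.Hom.comp_apply, a3, a5, h1])
      obtain ⟨k, hk⟩ := hψ.2 φ
      refine ⟨k⁻¹, DFunLike.ext _ _ fun v => ?_⟩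
      change F k⁻¹ v = g v
      rw [hF, inv_inv, hk]
      simp only [φ, BipEquiv.ofHoms_apply, Language.Hom.comp_apply, a1, a2]

end

/-! ### The extension property -/

section

variable {V : Type u} {X : Type v} [bipLang.Structure V] [bipLang.Structure X]

/-- The structure is a bipartite graph whose parts are the fibres of `p`. -/
structure IsBipWith (p : V → Bool) : Prop where
  part_iff : ∀ x y : V, BipPart x y ↔ p x = p y
  symm : ∀ x y : V, BipEdge x y → BipEdge y x
  edge_ne : ∀ x y : V, BipEdge x y → p x ≠ p y

theorem BipOf.isBipWith {V : Type u} {E : V → V → Prop} {p : V → Bool}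
    (hs : ∀ x y, E x y → E y x) (hE : ∀ x y, E x y → p x ≠ p y) :
    IsBipWith (V := BipOf E p) p :=
  ⟨fun _ _ => Iff.rfl, hs, hE⟩

theorem IsBipartiteGraph.exists_isBipWith (h : IsBipartiteGraph V) :
    ∃ p : V → Bool, IsBipWith p := by
  classical
  obtain ⟨V₀, V₁, hU, hd, hP⟩ := h.partition
  have key : ∀ x y : V, BipPart x y ↔ decide (x ∈ V₀) = decide (y ∈ V₀) := fun x y => by
    have h1 : ∀ z, z ∈ V₁ ↔ z ∉ V₀ := fun z =>
      ⟨fun hz hz' => Set.disjoint_left.1 hd hz' hz, fun hz =>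
        (hU.symm.subset (Set.mem_univ z)).resolve_left hz⟩
    rw [hP, h1, h1, decide_eq_decide]
    tauto
  exact ⟨fun x => decide (x ∈ V₀), key, h.symm,
    fun x y hE hp => h.edge_not_part x y hE ((key x y).2 hp)⟩

theorem IsBipWith.isBipartiteGraph {p : V → Bool} (h : IsBipWith p) : IsBipartiteGraph V where
  irrefl x hx := h.edge_ne x x hx rfl
  symm := h.symm
  partition := by
    refine ⟨{x | p x = true}, {x | p x = false}, ?_, ?_, fun x y => ?_⟩
    · ext x; cases hx : p x <;> simp [hx]
    · exact Set.disjoint_left.2 fun x (hx : p x = true) (hx' : p x = false) => by simp_all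
    · rw [h.part_iff]
      cases hx : p x <;> cases hy : p y <;> simp [hx, hy]
  edge_not_part x y hE hP := h.edge_ne x y hE ((h.part_iff x y).1 hP)

theorem IsBipWith.edge_comm {p : V → Bool} (h : IsBipWith p) {x y : V} :
    BipEdge x y ↔ BipEdge y x := ⟨h.symm x y, h.symm y x⟩

/-- The extension property that characterises the countable universal bipartite graph. -/
def HasExtension (p : V → Bool) : Prop :=
  ∀ (b : Bool) (F S : Finset V), (∀ x ∈ S, p x ≠ b) →
    ∃ v, v ∉ F ∧ p v = b ∧ ∀ x ∈ F, BipEdge x v ↔ x ∈ S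

/-- Adjoin to `F` an abstract vertex with the prescribed side and neighbours. The result is a finite
bipartite graph, so it embeds in `V`, and ultrahomogeneity carries the embedded copy of `F` back to
`F`. Since the partition relation only says whether sides agree, a reference vertex `a` in `F` is
needed to control the side of the new vertex. -/
theorem exists_extension_of_mem {p : V → Bool} [Countable V]
    (hV : IsCountableUniversalBipartiteGraph V) (hp : IsBipWith p) (b : Bool) (F S : Finset V)
    (hS : ∀ x ∈ S, p x ≠ b) {a : V} (ha : a ∈ F) :
    ∃ v, v ∉ F ∧ p v = b ∧ ∀ x ∈ F, BipEdge x v ↔ x ∈ S := by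
  classical
  let E : Option F → Option F → Prop
    | some x, some y => BipEdge (x : V) y
    | some x, none => (x : V) ∈ S
    | none, some x => (x : V) ∈ S
    | none, none => False
  let q : Option F → Bool := fun o => o.elim b fun x => p x
  have hq : IsBipWith (V := BipOf E q) q := by
    refine BipOf.isBipWith ?_ ?_
    · rintro (_ | x) (_ | y) h
      exacts [h, h, h, hp.symm _ _ h]
    · rintro (_ | x) (_ | y) h
      exacts [h.elim, (hS _ h).symm, hS _ h, hp.edge_ne _ _ h]
  have : Finite (BipOf E q) := inferInstanceAs (Finite (Option F))
  have hmem : CategoryTheory.Bundled.of (c := bipLang.Structure) (BipOf E q) ∈ Language.age bipLang V := by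
    rw [hV.age]; exact ⟨this, hq.isBipartiteGraph⟩
  obtain ⟨-, ⟨h : BipOf E q ↪[bipLang] V⟩⟩ := hmem
  let s : F → BipOf E q := fun x => (some x : Option F)
  let n : BipOf E q := (none : Option F)
  let T : bipLang.Substructure V := ⟨F, fun c => Empty.elim c⟩
  have hT : T.FG := by
    rw [Language.Substructure.fg_iff_finite]; exact inferInstanceAs (Finite F)
  let f : T ↪[bipLang] V := BipEmb.mk (fun x => h (s ⟨x.1, x.2⟩))
    (fun x y hxy => Subtype.ext (congrArg Subtype.val (Option.some.inj (h.injective hxy))))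
    (fun x y => by
      rw [BipEmb.edge_iff h]; exact BipEmb.edge_iff T.subtype)
    (fun x y => by
      rw [BipEmb.part_iff h, ← BipEmb.part_iff T.subtype, hp.part_iff]; exact Iff.rfl)
  obtain ⟨g, hg⟩ := hV.ultrahomogeneous T hT f
  have hg' : ∀ x (hx : x ∈ F), g x = h (s ⟨x, hx⟩) := fun x hx =>
    (DFunLike.congr_fun hg (⟨x, hx⟩ : T)).symm
  have hv : g (g.symm (h n)) = h n := g.apply_symm_apply _
  refine ⟨g.symm (h n), fun hF => ?_, ?_, fun x hx => ?_⟩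
  · rw [hg' _ hF] at hv
    exact Option.some_ne_none _ (h.injective hv)
  · have h1 : q (s ⟨a, ha⟩) = q n ↔ p a = p (g.symm (h n)) := by
      rw [← hp.part_iff, ← BipEquiv.part_iff g, hg' a ha, hv, BipEmb.part_iff h]
      exact Iff.rfl
    change p a = b ↔ _ at h1
    revert h1
    cases p a <;> cases b <;> cases p (g.symm (h n)) <;> simp
  · rw [← BipEquiv.edge_iff g, hg' x hx, hv, BipEmb.edge_iff h]
    exact Iff.rfl

theorem exists_vertex {p : V → Bool} [Countable V]
    (hV : IsCountableUniversalBipartiteGraph V) (hp : IsBipWith p) : ∃ a : V, p a = true := by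
  classical
  let q : ULift.{u} Bool → Bool := fun x => x.down
  have hq : IsBipWith (V := BipOf (fun _ _ => False) q) q :=
    BipOf.isBipWith (fun _ _ h => h) fun _ _ h => h.elim
  have : Finite (BipOf (fun _ _ => False) q) := inferInstanceAs (Finite (ULift.{u} Bool))
  have hmem : CategoryTheory.Bundled.of (c := bipLang.Structure) (BipOf (fun _ _ => False) q) ∈
      Language.age bipLang V := by
    rw [hV.age]; exact ⟨this, hq.isBipartiteGraph⟩
  obtain ⟨-, ⟨h : BipOf (fun _ _ => False) q ↪[bipLang] V⟩⟩ := hmem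
  have h1 := (BipEmb.part_iff h (x := ULift.up true) (y := ULift.up false)).trans
    (hq.part_iff _ _)
  rw [hp.part_iff] at h1
  by_contra! hne
  simp only [ne_eq, Bool.not_eq_true] at hne
  rw [hne, hne] at h1
  exact absurd (h1.1 rfl) (by simp [q])

theorem IsCountableUniversalBipartiteGraph.hasExtension {p : V → Bool} [Countable V]
    (hV : IsCountableUniversalBipartiteGraph V) (hp : IsBipWith p) : HasExtension p := by
  classical
  intro b F S hS
  obtain ⟨a, -⟩ := exists_vertex hV hp
  obtain ⟨v, h1, h2, h3⟩ :=
    exists_extension_of_mem hV hp b (insert a F) S hS (Finset.mem_insert_self a F)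
  exact ⟨v, fun h => h1 (Finset.mem_insert_of_mem h), h2,
    fun x hx => h3 x (Finset.mem_insert_of_mem hx)⟩

theorem isExtensionPair_of_hasExtension {p : V → Bool} {q : X → Bool} (hp : IsBipWith p)
    (hq : IsBipWith q) (hV : HasExtension p) : bipLang.IsExtensionPair X V := by
  classical
  rw [Language.isExtensionPair_iff_exists_embedding_closure_singleton_sup]
  intro T hT f m
  have hmem : ∀ x, x ∈ (Language.Substructure.closure bipLang {m} ⊔ T :
      bipLang.Substructure X) ↔ x = m ∨ x ∈ T := fun x => by
    rw [← Language.Substructure.closure_eq T, ← Language.Substructure.closure_union,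
      Language.Substructure.mem_closure_iff_of_isRelational, Language.Substructure.closure_eq]
    rfl
  by_cases hm : m ∈ T
  · have hle : (Language.Substructure.closure bipLang {m} ⊔ T : bipLang.Substructure X) ≤ T :=
      fun x hx => ((hmem x).1 hx).elim (fun h => h ▸ hm) id
    exact ⟨f.comp (Language.Substructure.inclusion hle), DFunLike.ext _ _ fun x => rfl⟩
  have : Finite T := hT.finite
  have := Fintype.ofFinite T
  have hpq : ∀ x y : T, p (f x) = p (f y) ↔ q x = q y := fun x y => by
    rw [← hp.part_iff, BipEmb.part_iff f, ← hq.part_iff]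
    exact (BipEmb.part_iff T.subtype).symm
  have hE : ∀ x y : T, BipEdge (f x) (f y) ↔ BipEdge (x : X) y := fun x y =>
    (BipEmb.edge_iff f).trans (BipEmb.edge_iff T.subtype).symm
  -- The embedding `f` may match the sides of `X` with those of `V` directly or swapped. Any vertex
  -- of `T` tells which, and if `T` is empty either side will do.
  obtain ⟨b, hb⟩ : ∃ b, ∀ x : T, p (f x) = b ↔ q x = q m := by
    by_cases hne : Nonempty T
    · obtain ⟨a⟩ := hne
      refine ⟨if q a = q m then p (f a) else !p (f a), fun x => ?_⟩
      have := hpq x a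
      split_ifs with h
      · rw [this, h]
      · revert this h
        cases p (f x) <;> cases p (f a) <;> cases q x <;> cases q a <;> cases q m <;> simp
    · exact ⟨true, fun x => (hne ⟨x⟩).elim⟩
  obtain ⟨v, hvF, hvb, hv⟩ := hV b (Finset.univ.image f)
    ((Finset.univ.filter fun x : T => BipEdge (x : X) m).image f) (by
      simp only [Finset.mem_image, Finset.mem_filter]
      rintro _ ⟨x, ⟨-, hx⟩, rfl⟩ h
      exact hq.edge_ne _ _ hx ((hb x).1 h))
  have hvne : ∀ x : T, f x ≠ v := fun x h => hvF (by simp [← h])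
  have hvE : ∀ x : T, BipEdge (f x) v ↔ BipEdge (x : X) m := fun x => by
    rw [hv _ (by simp)]
    simp [f.injective.eq_iff]
  have hvP : ∀ x : T, BipPart (f x) v ↔ BipPart (x : X) m := fun x => by
    rw [hp.part_iff, hvb, hb, hq.part_iff]
  have hirrV : ∀ x : V, ¬ BipEdge x x := fun x h => hp.edge_ne _ _ h rfl
  have hirrX : ∀ x : X, ¬ BipEdge x x := fun x h => hq.edge_ne _ _ h rfl
  have hsP : ∀ x y : V, BipPart x y ↔ BipPart y x := fun x y => by
    rw [hp.part_iff, hp.part_iff, eq_comm]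
  have hsP' : ∀ x y : X, BipPart x y ↔ BipPart y x := fun x y => by
    rw [hq.part_iff, hq.part_iff, eq_comm]
  let g : X → V := fun x => if h : x ∈ T then f ⟨x, h⟩ else v
  have hgT : ∀ x : T, g x = f x := fun x => by simp [g]
  have hgm : g m = v := by simp [g, hm]
  refine ⟨BipEmb.mk (fun x => g x) ?_ ?_ ?_, DFunLike.ext _ _ fun x => (hgT x).symm⟩
  · rintro ⟨x, hx⟩ ⟨y, hy⟩ h
    change g x = g y at h
    refine Subtype.ext ?_
    change x = y
    rcases (hmem x).1 hx with rfl | hx' <;> rcases (hmem y).1 hy with rfl | hy'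
    · rfl
    · rw [hgm, hgT ⟨y, hy'⟩] at h; exact (hvne _ h.symm).elim
    · rw [hgm, hgT ⟨x, hx'⟩] at h; exact (hvne _ h).elim
    · rw [hgT ⟨x, hx'⟩, hgT ⟨y, hy'⟩] at h; exact congrArg Subtype.val (f.injective h)
  · rintro ⟨x, hx⟩ ⟨y, hy⟩
    refine Iff.trans ?_ (BipEmb.edge_iff (Language.Substructure.subtype _))
    change BipEdge (g x) (g y) ↔ BipEdge x y
    rcases (hmem x).1 hx with rfl | hx' <;> rcases (hmem y).1 hy with rfl | hy'
    · simp [hirrV, hirrX]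
    · rw [hgm, hgT ⟨y, hy'⟩, hp.edge_comm, hvE, hq.edge_comm]
    · rw [hgm, hgT ⟨x, hx'⟩, hvE]
    · rw [hgT ⟨x, hx'⟩, hgT ⟨y, hy'⟩, hE]
  · rintro ⟨x, hx⟩ ⟨y, hy⟩
    refine Iff.trans ?_ (BipEmb.part_iff (Language.Substructure.subtype _))
    change BipPart (g x) (g y) ↔ BipPart x y
    rcases (hmem x).1 hx with rfl | hx' <;> rcases (hmem y).1 hy with rfl | hy'
    · simp [hp.part_iff, hq.part_iff]
    · rw [hgm, hgT ⟨y, hy'⟩, hsP, hvP, hsP']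
    · rw [hgm, hgT ⟨x, hx'⟩, hvP]
    · rw [hgT ⟨x, hx'⟩, hgT ⟨y, hy'⟩, hp.part_iff, hpq, hq.part_iff]

/-- Countable bipartite graphs with the extension property are isomorphic. -/
theorem nonempty_equiv_of_hasExtension [Countable V] [Countable X] {p : V → Bool} {q : X → Bool}
    (hp : IsBipWith p) (hq : IsBipWith q) (hV : HasExtension p) (hX : HasExtension q) :
    Nonempty (X ≃[bipLang] V) := by
  have : IsEmpty (⊥ : bipLang.Substructure X) := ⟨fun x => by
    have h : (x : X) ∈ Language.Substructure.closure bipLang (∅ : Set X) := by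
      rw [Language.Substructure.closure_empty]; exact x.2
    rw [Language.Substructure.mem_closure_iff_of_isRelational] at h
    exact h⟩
  have : Countable (Σ l, bipLang.Functions l) :=
    Function.Injective.countable (f := fun _ => ()) fun x => Empty.elim x.2
  let g : (⊥ : bipLang.Substructure X) ↪[bipLang] V :=
    BipEmb.mk isEmptyElim (fun x => isEmptyElim x) (fun x => isEmptyElim x)
      (fun x => isEmptyElim x)
  obtain ⟨f, -⟩ := Language.equiv_between_cg (Language.Structure.cg_iff_countable.2 ‹_›)
    (Language.Structure.cg_iff_countable.2 ‹_›)
    ⟨⟨⊥, g.toHom.range, g.equivRange⟩, Language.Substructure.fg_bot⟩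
    (isExtensionPair_of_hasExtension hp hq hV) (isExtensionPair_of_hasExtension hq hp hX)
  exact ⟨f⟩

end

/-! ### Retracts of the countable universal bipartite graph -/

section

variable {V : Type u} {X : Type v} [bipLang.Structure V] [bipLang.Structure X]

/-- Every finite set of vertices in one part has a common neighbour in the other part. -/
def HasCommonNeighbours (p : V → Bool) : Prop :=
  ∀ (b : Bool) (S : Finset V), (∀ x ∈ S, p x ≠ b) → ∃ v, p v = b ∧ ∀ x ∈ S, BipEdge x v

theorem BipOf.hasCommonNeighbours_iff {V : Type u} {E : V → V → Prop} {p : V → Bool} :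
    HasCommonNeighbours (V := BipOf E p) p ↔
      ∀ (b : Bool) (S : Finset V), (∀ x ∈ S, p x ≠ b) → ∃ v, p v = b ∧ ∀ x ∈ S, E x v := Iff.rfl

/-- The image of `S` under the section has a common neighbour in `V`, and the retraction sends it to
a common neighbour of `S`. -/
theorem SplitsThrough.hasCommonNeighbours {e : BipEnd V} (he : SplitsThrough e X) {p : V → Bool}
    (hp : IsBipWith p) (hV : HasExtension p) :
    ∃ q : X → Bool, IsBipWith q ∧ HasCommonNeighbours q := by
  classical
  obtain ⟨i, r, h1, -⟩ := he
  have hq : IsBipWith (p ∘ i) := by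
    refine ⟨fun x y => ?_, fun x y h => ?_, fun x y h => hp.edge_ne _ _ (BipHom.edge i h)⟩
    · refine Iff.trans ⟨BipHom.part i, fun h => ?_⟩ (hp.part_iff _ _)
      simpa only [h1] using BipHom.part r h
    · simpa only [h1] using BipHom.edge r (hp.symm _ _ (BipHom.edge i h))
  refine ⟨p ∘ i, hq, fun b S hS => ?_⟩
  -- Joining the new vertex to some `a` off side `b` forces its image onto side `b`, even when `S`
  -- is empty. If no such `a` exists, then `S` is empty and any vertex serves.
  by_cases hne : ∃ a, p (i a) ≠ b
  · obtain ⟨a, ha⟩ := hne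
    obtain ⟨v, -, hvb, hv⟩ := hV b ((insert a S).image i) ((insert a S).image i) (by
      simp only [Finset.mem_image, Finset.mem_insert]
      rintro _ ⟨x, rfl | hx, rfl⟩
      exacts [ha, hS x hx])
    have hE : ∀ x ∈ insert a S, BipEdge x (r v) := fun x hx => by
      have hx' := Finset.mem_image_of_mem i hx
      simpa only [h1] using BipHom.edge r ((hv _ hx').2 hx')
    refine ⟨r v, ?_, fun x hx => hE x (Finset.mem_insert_of_mem hx)⟩
    have := hq.edge_ne _ _ (hE a (Finset.mem_insert_self a S))
    revert this ha
    simp only [Function.comp_apply]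
    cases p (i a) <;> cases p (i (r v)) <;> cases b <;> simp
  · push Not at hne
    obtain ⟨v, -⟩ := hV b ∅ ∅ (by simp)
    exact ⟨r v, hne _, fun x hx => (hS x hx (hne x)).elim⟩

/-- The adjacency relation of a generic cover of the graph `X`: a random-like subgraph of a
blow-up of `X` that contains a copy of `X`. -/
def coverAdj (c : X × Finset ℕ → ℕ) (x y : X × Finset ℕ) : Prop :=
  BipEdge x.1 y.1 ∧ ((x.2 = ∅ ∧ y.2 = ∅) ∨ c x ∈ y.2 ∨ c y ∈ x.2)

/-- Over a common neighbour `y` of the projection of `S` lie vertices whose labels list the codes of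
`S`. One further code `K` in the label makes the vertex fresh, so that its only neighbours in `F`
are those listed. -/
theorem hasExtension_cover {q : X → Bool} (hX : HasCommonNeighbours q)
    {c : X × Finset ℕ → ℕ} (hc : Function.Injective c) :
    HasExtension (V := BipOf (coverAdj c) fun x => q x.1) fun x => q x.1 := by
  classical
  intro b F S hS
  change Finset (X × Finset ℕ) at F S
  obtain ⟨y, hyb, hy⟩ := hX b (S.image Prod.fst) (by
    simp only [Finset.mem_image]
    rintro _ ⟨x, hx, rfl⟩
    exact hS x hx)
  let C := S.image c
  -- Distinct `K` give distinct codes of the new vertex, so some `K` outside `C` and the codes of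
  -- `F` yields a code that occurs neither in a label of `F` nor as the code of a vertex of `F`.
  -- Having `K` in the label also keeps it nonempty, which rules out the first clause of `coverAdj`.
  have hinf : ((fun K => c (y, insert K C)) ''
      (((C ∪ F.image c : Finset ℕ) : Set ℕ)ᶜ)).Infinite := by
    refine Set.Infinite.image ?_ (Finset.finite_toSet _).infinite_compl
    intro K hK L _ h
    simp only [Set.mem_compl_iff, Finset.mem_coe, Finset.mem_union, not_or] at hK
    exact (Finset.insert_inj hK.1).1 (congrArg Prod.snd (hc h))
  obtain ⟨_, ⟨K, hK, rfl⟩, hKF⟩ := hinf.exists_notMem_finset (F.biUnion Prod.snd ∪ F.image c)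
  simp only [Set.mem_compl_iff, Finset.mem_coe, Finset.mem_union, not_or, Finset.mem_biUnion,
    not_exists, not_and] at hK hKF
  let v : X × Finset ℕ := (y, insert K C)
  refine ⟨v, fun h => hKF.2 (Finset.mem_image_of_mem c h), hyb, fun x hx => ?_⟩
  change BipEdge x.1 y ∧ ((x.2 = ∅ ∧ insert K C = ∅) ∨ c x ∈ insert K C ∨ c v ∈ x.2) ↔ _
  constructor
  · rintro ⟨-, ⟨-, h⟩ | h | h⟩
    · exact absurd h (Finset.insert_ne_empty _ _)
    · rcases Finset.mem_insert.1 h with h | h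
      · exact (hK.2 (h ▸ Finset.mem_image_of_mem c hx)).elim
      · obtain ⟨z, hz, hzx⟩ := Finset.mem_image.1 h
        exact hc hzx ▸ hz
    · exact (hKF.1 x hx h).elim
  · intro h
    exact ⟨hy _ (Finset.mem_image_of_mem _ h),
      Or.inr (Or.inl (Finset.mem_insert_of_mem (Finset.mem_image_of_mem c h)))⟩

/-- A countable bipartite graph in which finite sets have common neighbours is a retract. -/
theorem exists_retract [Countable V] [Countable X] {p : V → Bool} {q : X → Bool}
    (hp : IsBipWith p) (hV : HasExtension p) (hq : IsBipWith q) (hX : HasCommonNeighbours q) :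
    ∃ (i : X →[bipLang] V) (r : V →[bipLang] X), ∀ x, r (i x) = x := by
  obtain ⟨c, hc⟩ := exists_injective_nat (X × Finset ℕ)
  let Y := BipOf (coverAdj c) fun x => q x.1
  have hY : IsBipWith (V := Y) fun x => q x.1 := by
    refine BipOf.isBipWith ?_ fun x y h => hq.edge_ne _ _ h.1
    rintro x y ⟨h, h'⟩
    exact ⟨hq.symm _ _ h, by tauto⟩
  have : Countable Y := inferInstanceAs (Countable (X × Finset ℕ))
  obtain ⟨φ⟩ := nonempty_equiv_of_hasExtension hp hY hV (hasExtension_cover hX hc)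
  -- The vertices with empty label form a copy of `X`, which is what the first clause of `coverAdj`
  -- provides.
  let j : X →[bipLang] Y := BipHom.mk (fun x => ((x, ∅) : X × Finset ℕ))
    (fun x y h => ⟨h, Or.inl ⟨rfl, rfl⟩⟩) (fun x y h => (hq.part_iff x y).1 h)
  let s : Y →[bipLang] X := BipHom.mk (fun x : X × Finset ℕ => x.1)
    (fun x y h => h.1) (fun x y h => (hq.part_iff _ _).2 h)
  refine ⟨φ.toHom.comp j, s.comp φ.symm.toHom, fun x => ?_⟩
  change s (φ.symm (φ (j x))) = x
  rw [φ.symm_apply_apply]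
  rfl

theorem exists_splitsThrough [Countable V] [Countable X] {p : V → Bool} {q : X → Bool}
    (hp : IsBipWith p) (hV : HasExtension p) (hq : IsBipWith q) (hX : HasCommonNeighbours q) :
    ∃ e : BipEnd V, SplitsThrough e X := by
  obtain ⟨i, r, h⟩ := exists_retract hp hV hq hX
  exact ⟨i.comp r, i, r, h, fun _ => rfl⟩

/-! ### Counting idempotents with a given image -/

theorem mk_bipEnd_le [Countable V] : Cardinal.mk (BipEnd V) ≤ Cardinal.continuum := by
  refine (Cardinal.mk_le_of_injective (DFunLike.coe_injective (F := BipEnd V))).trans ?_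
  rw [Cardinal.mk_pi, Cardinal.prod_const, Cardinal.lift_id]
  exact (Cardinal.power_le_power_right (Cardinal.mk_le_aleph0)).trans
    ((Cardinal.power_le_power_left Cardinal.aleph0_ne_zero Cardinal.mk_le_aleph0).trans
      Cardinal.aleph0_power_aleph0.le)

/-- The adjacency relation of the graph `X` with additional vertices that are joined to the
common neighbours of `a` and `a'`. -/
def addCommonAdj (a a' : X) : X ⊕ ℕ → X ⊕ ℕ → Prop
  | .inl x, .inl y => BipEdge x y
  | .inl x, .inr _ => BipEdge x a ∧ BipEdge x a'
  | .inr _, .inl y => BipEdge y a ∧ BipEdge y a'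
  | .inr _, .inr _ => False

/-- The enlarged graph is still a retract of `V`. It retracts onto `X` by sending each added vertex
to `a` or to `a'`, because its neighbours are adjacent to both; every subset of the naturals
prescribes such choices. -/
theorem continuum_le_mk_splitsThrough [Countable V] [Countable X] {p : V → Bool} {q : X → Bool}
    (hp : IsBipWith p) (hV : HasExtension p) (hq : IsBipWith q) (hX : HasCommonNeighbours q)
    {a a' : X} (hne : a ≠ a') (haa : q a = q a') :
    Cardinal.continuum ≤ Cardinal.mk {e : BipEnd V // SplitsThrough e X} := by
  classical
  let q' : X ⊕ ℕ → Bool := Sum.elim q fun _ => q a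
  let Y := BipOf (addCommonAdj a a') q'
  have hY : IsBipWith (V := Y) q' := by
    refine BipOf.isBipWith ?_ ?_
    · rintro (x | k) (y | l) h
      exacts [hq.symm _ _ h, h, h, h]
    · rintro (x | k) (y | l) h
      exacts [hq.edge_ne _ _ h, hq.edge_ne _ _ h.1, (hq.edge_ne _ _ h.1).symm, h.elim]
  have hYc : HasCommonNeighbours (V := Y) q' := by
    refine BipOf.hasCommonNeighbours_iff.2 fun b S hS => ?_
    by_cases hb : q a = b
    · obtain ⟨v, hvb, hv⟩ := hX b S.toLeft fun x hx => hS (.inl x) (by simpa using hx)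
      refine ⟨.inl v, hvb, ?_⟩
      rintro (x | k) hx
      · exact hv x (by simpa using hx)
      · exact (hS _ hx hb).elim
    -- Including `a` and `a'` ensures that `v` is adjacent to all the added vertices.
    · obtain ⟨v, hvb, hv⟩ := hX b (insert a (insert a' S.toLeft)) (by
        simp only [Finset.mem_insert]
        rintro x (rfl | rfl | hx)
        exacts [hb, haa ▸ hb, hS (.inl x) (by simpa using hx)])
      refine ⟨.inl v, hvb, ?_⟩
      rintro (x | k) hx
      · exact hv x (by simpa using Or.inr (Or.inr hx))
      · exact ⟨hq.symm _ _ (hv a (by simp)), hq.symm _ _ (hv a' (by simp))⟩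
  have : Countable Y := inferInstanceAs (Countable (X ⊕ ℕ))
  obtain ⟨i, r, hir⟩ := exists_retract hp hV hY hYc
  let j : X →[bipLang] Y := BipHom.mk (fun x => (.inl x : X ⊕ ℕ))
    (fun x y h => h) (fun x y h => (hq.part_iff x y).1 h)
  let choice : Set ℕ → ℕ → X := fun A k => if k ∈ A then a else a'
  have hchoice : ∀ A k, q (choice A k) = q a := fun A k => by
    simp only [choice]; split_ifs <;> simp [haa]
  let ρ : Set ℕ → (Y →[bipLang] X) := fun A =>
    BipHom.mk (Sum.elim id (choice A) : X ⊕ ℕ → X)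
      (by
        have key : ∀ x k, BipEdge x a → BipEdge x a' → BipEdge x (choice A k) :=
          fun x k h h' => by simp only [choice]; split_ifs <;> assumption
        rintro (x | k) (y | l) h
        exacts [h, key _ _ h.1 h.2, hq.symm _ _ (key _ _ h.1 h.2), h.elim])
      (by
        have key : ∀ x, q (Sum.elim id (choice A) x) = q' x := by
          rintro (x | k)
          exacts [rfl, hchoice A k]
        intro x y h
        exact (hq.part_iff _ _).2 ((key x).trans (Eq.trans h (key y).symm)))
  have hρ : ∀ A x, ρ A (j x) = x := fun A x => rfl
  let z : ℕ → Y := fun k => (.inr k : X ⊕ ℕ)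
  have hρ' : ∀ A k, ρ A (z k) = choice A k := fun A k => rfl
  let F : Set ℕ → {e : BipEnd V // SplitsThrough e X} := fun A =>
    ⟨(i.comp j).comp ((ρ A).comp r), i.comp j, (ρ A).comp r, fun x => by
      simp only [Language.Hom.comp_apply, hir, hρ], fun _ => rfl⟩
  have hF : Function.Injective F := by
    intro A A' h
    ext k
    have h1 := DFunLike.congr_fun (congrArg Subtype.val h) (i (z k))
    have h2 : choice A k = choice A' k := by
      have := congrArg (fun v => ρ A (r v)) h1
      simpa only [F, Language.Hom.comp_apply, hir, hρ, hρ'] using this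
    simp only [choice] at h2
    split_ifs at h2 with h3 h4 h4
    exacts [iff_of_true h3 h4, (hne h2).elim, (hne h2.symm).elim, iff_of_false h3 h4]
  have := Cardinal.lift_mk_le_lift_mk_of_injective hF
  rwa [Cardinal.mk_set_nat, Cardinal.lift_continuum, Cardinal.lift_id'] at this

end

/-! ### Idempotents whose image is a single edge -/

section

variable {V : Type u} {X : Type v} [bipLang.Structure V] [bipLang.Structure X]

theorem CompleteBip.isBipWith (α β : Type) :
    IsBipWith (V := CompleteBip α β) Sum.isLeft where
  part_iff _ _ := Iff.rfl
  symm _ _ h := Ne.symm h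
  edge_ne _ _ h := h

theorem CompleteBip.edge_iff {α β : Type} {x y : CompleteBip α β} :
    BipEdge x y ↔ Sum.isLeft x ≠ Sum.isLeft y := Iff.rfl

/-- A bipartite graph with an edge that has at most one vertex in each part is `K_{1,1}`. -/
theorem nonempty_equiv_completeBip {q : X → Bool} (hq : IsBipWith q) {a b : X}
    (hE : BipEdge a b) (hinj : Function.Injective q) :
    Nonempty (X ≃[bipLang] CompleteBip Unit Unit) := by
  have hab := hq.edge_ne _ _ hE
  have hcases : ∀ x, x = a ∨ x = b := fun x => by
    by_contra! h
    have h1 := hinj.ne h.1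
    have h2 := hinj.ne h.2
    revert h1 h2 hab
    cases q x <;> cases q a <;> cases q b <;> simp
  have hP : ∀ x y, BipPart x y ↔ x = y := fun x y => (hq.part_iff x y).trans hinj.eq_iff
  have hne : a ≠ b := fun h => hab (congrArg q h)
  have hfE : ∀ x y, BipEdge x y ↔ x ≠ y := fun x y => by
    refine ⟨fun h h' => hq.edge_ne _ _ h (congrArg q h'), fun h => ?_⟩
    rcases hcases x with rfl | rfl <;> rcases hcases y with rfl | rfl
    exacts [(h rfl).elim, hE, hq.symm _ _ hE, (h rfl).elim]
  classical
  let g : X ≃ Unit ⊕ Unit :=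
    { toFun := fun x => if x = a then .inl () else .inr ()
      invFun := Sum.elim (fun _ => a) fun _ => b
      left_inv := fun x => by rcases hcases x with rfl | rfl <;> simp [hne.symm]
      right_inv := by rintro (_ | _) <;> simp [hne.symm] }
  have hg : ∀ x y, Sum.isLeft (g x) = Sum.isLeft (g y) ↔ x = y := fun x y => by
    rcases hcases x with rfl | rfl <;> rcases hcases y with rfl | rfl <;>
      simp [g, hne, hne.symm]
  exact ⟨BipEquiv.mk (Y := CompleteBip Unit Unit) g
    (fun x y => (CompleteBip.edge_iff.trans (not_congr (hg x y))).trans (hfE x y).symm)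
    (fun x y => (hg x y).trans (hP x y).symm)⟩

theorem HasCommonNeighbours.exists_edge {q : X → Bool} (hX : HasCommonNeighbours q) : ∃ a b : X, BipEdge a b := by
  obtain ⟨a, ha, -⟩ := hX true ∅ (by simp)
  obtain ⟨b, -, hb⟩ := hX false {a} (by simp [ha])
  exact ⟨a, b, hb a (by simp)⟩

theorem IsIdempotentElem.imageIsoK11_iff {f : BipEnd V} (hf : IsIdempotentElem f) :
    ImageIsoK11 f ↔ SplitsThrough f (CompleteBip Unit Unit) :=
  ⟨fun ⟨φ⟩ => hf.splitsThrough_image.congr φ,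
    fun h => hf.splitsThrough_image.nonempty_equiv h⟩

/-- The image contains an edge, so if it is not a single edge then two of its vertices share a part,
and folding applies. -/
theorem mk_groupHClass_eq_continuum [Countable V] {p : V → Bool} (hp : IsBipWith p)
    (hV : HasExtension p) {f : BipEnd V} (hf : IsIdempotentElem f) (hK : ¬ ImageIsoK11 f) :
    Cardinal.mk {H : Set (BipEnd V) // IsGroupHClass H ∧ H ⊆ dClass f} =
      Cardinal.continuum := by
  have hs := hf.splitsThrough_image
  obtain ⟨q, hq, hX⟩ := hs.hasCommonNeighbours hp hV
  have hninj : ¬ Function.Injective q := fun hinj => by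
    obtain ⟨a, b, hab⟩ := hX.exists_edge
    exact hK (nonempty_equiv_completeBip hq hab hinj)
  rw [Function.not_injective_iff] at hninj
  obtain ⟨a, a', haa, hne⟩ := hninj
  have : Countable (BipImage f) := inferInstanceAs (Countable (Set.range f))
  rw [← Cardinal.mk_congr (groupHClassEquiv f)]
  apply le_antisymm ((Cardinal.mk_subtype_le _).trans mk_bipEnd_le)
  refine (continuum_le_mk_splitsThrough hp hV hq hX hne haa).trans ?_
  exact Cardinal.mk_le_of_injective (f := fun e => ⟨e.1, e.2.isIdempotentElem,
    (hs.mem_dClass_iff e.2.isIdempotentElem).2 e.2⟩)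
    fun e e' h => Subtype.ext (Subtype.mk.inj h)

/-- The vertices of an edge determine the retraction onto it. -/
theorem exists_splitsThrough_edge {p : V → Bool} (hp : IsBipWith p) {a b : V}
    (hab : BipEdge a b) :
    ∃ e : BipEnd V, SplitsThrough e (CompleteBip Unit Unit) ∧
      ∀ v, e v = if p v = p a then a else b := by
  have hne := hp.edge_ne _ _ hab
  let i : CompleteBip Unit Unit →[bipLang] V :=
    BipHom.mk (Sum.elim (fun _ => a) fun _ => b)
      (by
        rintro (_ | _) (_ | _) h
        exacts [(h rfl).elim, hab, hp.symm _ _ hab, (h rfl).elim])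
      (by
        rintro (_ | _) (_ | _) h
        exacts [(hp.part_iff _ _).2 rfl, absurd h (by simp [BipPart, Language.Structure.RelMap]),
          absurd h (by simp [BipPart, Language.Structure.RelMap]), (hp.part_iff _ _).2 rfl])
  let r : V →[bipLang] CompleteBip Unit Unit :=
    BipHom.mk (fun v => if p v = p a then .inl () else .inr ())
      (by
        intro x y h
        have := hp.edge_ne _ _ h
        rw [CompleteBip.edge_iff]
        revert this
        cases p x <;> cases p y <;> cases p a <;> simp)
      (by
        intro x y h
        rw [hp.part_iff] at h
        rw [h]
        exact ((CompleteBip.isBipWith Unit Unit).part_iff _ _).2 rfl)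
  refine ⟨i.comp r, ⟨i, r, ?_, fun _ => rfl⟩, fun v => ?_⟩
  · rintro (_ | _)
    · exact if_pos rfl
    · exact if_neg hne.symm
  · change i (if p v = p a then Sum.inl () else Sum.inr ()) = _
    split_ifs <;> rfl

/-- Preserving the partition relation leaves no freedom: the side of `v` decides to which end of the
edge it goes. -/
theorem SplitsThrough.eq_of_completeBip {p : V → Bool} (hp : IsBipWith p) {e : BipEnd V}
    (he : SplitsThrough e (CompleteBip Unit Unit)) :
    ∃ a b : V, ∀ v, e v = if p v = p a then a else b := by
  obtain ⟨i, r, h1, h2⟩ := he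
  let l : CompleteBip Unit Unit := .inl ()
  let l' : CompleteBip Unit Unit := .inr ()
  refine ⟨i l, i l', fun v => ?_⟩
  have h3 : p v = p (i l) ↔ Sum.isLeft (r v) = true := by
    rw [← hp.part_iff]
    constructor
    · intro h
      have := BipHom.part r h
      rwa [h1, (CompleteBip.isBipWith Unit Unit).part_iff] at this
    · intro h
      by_contra h'
      have hE : BipEdge (i l) (i l') := BipHom.edge i (CompleteBip.edge_iff.2 (by simp [l, l']))
      have h4 : BipPart v (i l') := by
        rw [hp.part_iff] at *
        have := hp.edge_ne _ _ hE
        revert this h'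
        cases p v <;> cases p (i l) <;> cases p (i l') <;> simp
      have h5 := BipHom.part r h4
      rw [h1, (CompleteBip.isBipWith Unit Unit).part_iff, h] at h5
      simp [l'] at h5
  rw [← h2]
  rcases hr : r v with ⟨⟩ | ⟨⟩
  · rw [if_pos (h3.2 (by rw [hr]; rfl))]
  · rw [if_neg (fun h => by have := h3.1 h; rw [hr] at this; simp at this)]

theorem mk_splitsThrough_completeBip [Countable V] {p : V → Bool} (hp : IsBipWith p)
    (hV : HasExtension p) :
    Cardinal.mk {e : BipEnd V // SplitsThrough e (CompleteBip Unit Unit)} = Cardinal.aleph0 := by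
  apply le_antisymm
  · have : Countable {e : BipEnd V // SplitsThrough e (CompleteBip Unit Unit)} := by
      choose a b hab using fun e : {e : BipEnd V // SplitsThrough e (CompleteBip Unit Unit)} =>
        e.2.eq_of_completeBip hp
      refine Function.Injective.countable (f := fun e => (a e, b e)) fun e e' h => ?_
      rw [Prod.mk.injEq] at h
      exact Subtype.ext (DFunLike.ext _ _ fun v => by rw [hab, hab, h.1, h.2])
    exact Cardinal.mk_le_aleph0
  · obtain ⟨a, -, ha, -⟩ := hV true ∅ ∅ (by simp)
    -- The extension property gives `a` a neighbour outside any finite set; edges at this one vertex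
    -- already provide enough retractions.
    have hinf : {b : V | BipEdge a b}.Infinite := by
      classical
      intro hfin
      obtain ⟨v, hv, -, h⟩ := hV false (insert a hfin.toFinset) {a} (by simp [ha])
      exact hv (Finset.mem_insert_of_mem (by simpa using (h a (by simp)).2 (by simp)))
    have := hinf.to_subtype
    choose e he hev using fun b : {b : V | BipEdge a b} => exists_splitsThrough_edge hp b.2
    refine (Cardinal.aleph0_le_mk {b : V | BipEdge a b}).trans
      (Cardinal.mk_le_of_injective (f := fun b => ⟨e b, he b⟩) fun b b' h => ?_)
    have h1 := DFunLike.congr_fun (congrArg Subtype.val h) (b : V)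
    have h2 : p (b : V) ≠ p a := (hp.edge_ne _ _ b.2).symm
    simp only [hev, if_neg h2] at h1
    exact Subtype.ext h1

/-- The automorphism of `K_{1,1}` that exchanges the two vertices. -/
def completeBipSwap : CompleteBip Unit Unit ≃[bipLang] CompleteBip Unit Unit :=
  BipEquiv.mk (Equiv.sumComm Unit Unit)
    (by rintro (_ | _) (_ | _) <;> simp [CompleteBip.edge_iff])
    (by rintro (_ | _) (_ | _) <;> simp [(CompleteBip.isBipWith Unit Unit).part_iff])

theorem SplitsThrough.isIsoToGroup_completeBip {e : BipEnd V}
    (he : SplitsThrough e (CompleteBip Unit Unit)) :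
    IsIsoToGroup (hClass e) (Multiplicative (ZMod 2)) := by
  let l : CompleteBip Unit Unit := .inl ()
  let l' : CompleteBip Unit Unit := .inr ()
  let ψ : Multiplicative (ZMod 2) → (CompleteBip Unit Unit ≃[bipLang] CompleteBip Unit Unit) :=
    fun g => if g = 1 then Language.Equiv.refl _ _ else completeBipSwap
  have hψ1 : ψ 1 = Language.Equiv.refl _ _ := if_pos rfl
  have hψ2 : ψ (Multiplicative.ofAdd 1) = completeBipSwap := if_neg (by decide)
  have hG : ∀ g : Multiplicative (ZMod 2), g = 1 ∨ g = Multiplicative.ofAdd 1 := by decide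
  have hsw : ∀ x, completeBipSwap (completeBipSwap x) = x := by rintro (_ | _) <;> rfl
  have hl : completeBipSwap l = l' := rfl
  refine he.isIsoToGroup ψ ⟨?_, fun φ => ?_⟩ ?_
  · intro g h hgh
    rcases hG g with rfl | rfl <;> rcases hG h with rfl | rfl
    · rfl
    · rw [hψ1, hψ2] at hgh
      exact absurd (DFunLike.congr_fun hgh l) (by rw [hl]; exact Sum.inl_ne_inr)
    · rw [hψ1, hψ2] at hgh
      exact absurd (DFunLike.congr_fun hgh l) (by rw [hl]; exact Sum.inr_ne_inl)
    · rfl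
  · have hc : ∀ x : CompleteBip Unit Unit, x = l ∨ x = l' := by
      rintro (_ | _)
      exacts [Or.inl rfl, Or.inr rfl]
    have hll : l ≠ l' := Sum.inl_ne_inr
    rcases hc (φ l) with h | h <;> rcases hc (φ l') with h' | h'
    · exact (hll (φ.injective (h.trans h'.symm))).elim
    · refine ⟨1, hψ1 ▸ DFunLike.ext _ _ fun x => ?_⟩
      rcases hc x with rfl | rfl
      exacts [h.symm, h'.symm]
    · refine ⟨Multiplicative.ofAdd 1, hψ2 ▸ DFunLike.ext _ _ fun x => ?_⟩
      rcases hc x with rfl | rfl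
      exacts [h.symm, h'.symm]
    · exact (hll (φ.injective (h.trans h'.symm))).elim
  · intro g h x
    rcases hG g with rfl | rfl <;> rcases hG h with rfl | rfl
    · rw [one_mul, hψ1]; rfl
    · rw [one_mul, hψ1]; rfl
    · rw [mul_one, hψ1]; rfl
    · have : (Multiplicative.ofAdd (1 : ZMod 2)) * Multiplicative.ofAdd 1 = 1 := by decide
      rw [this, hψ1, hψ2, hsw]; rfl

end

/-! ### Bipartite graphs with a prescribed automorphism group -/

section

variable {W : Type v}

/-- The vertices of the bipartite graph that encodes a graph `Γ` and a set of natural numbers. The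
first four constructors form one part, the last three the other. -/
inductive Coding (Γ : SimpleGraph W) : Type v
  | top
  | marker
  | point (n : ℕ)
  | vertex (x : W)
  | cotop
  | level (k : ℕ)
  | edge (e : Γ.edgeSet)

namespace Coding

variable {Γ : SimpleGraph W}

/-- The part of a vertex. -/
def side : Coding Γ → Bool
  | top | marker | point _ | vertex _ => true
  | cotop | level _ | edge _ => false

/-- The set of levels that are joined to the marker. -/
def code (A : Set ℕ) : Set ℕ := {k | Even k ∨ ∃ n ∈ A, k = 2 * n + 3}

/-- Only the odd numbers from 3 on carry information about `A`. The number 0 always belongs to the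
code and 1 never does, which separates `marker` from the `vertex` vertices and from `top`; the even
numbers give `marker` infinite degree. -/
theorem code_injective : Function.Injective code := by
  have key : ∀ A n, 2 * n + 3 ∈ code A ↔ n ∈ A := fun A n => by
    constructor
    · rintro (h | ⟨m, hm, h⟩)
      · obtain ⟨t, ht⟩ := h; omega
      · obtain rfl : n = m := by omega
        exact hm
    · exact fun h => Or.inr ⟨n, h, rfl⟩
  intro A B h
  ext n
  rw [← key, h, key]

theorem zero_mem_code (A : Set ℕ) : 0 ∈ code A := Or.inl (by simp)

theorem one_notMem_code (A : Set ℕ) : 1 ∉ code A := by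
  rintro (h | ⟨n, -, h⟩)
  · simp at h
  · omega

/-- The incidence relation from the first to the second part. -/
def inc (A : Set ℕ) : Coding Γ → Coding Γ → Prop
  | top, cotop | top, level _ | top, edge _ => True
  | marker, cotop | point _, cotop | vertex _, cotop => True
  | marker, level k => k ∈ code A
  | point n, level k => k < n
  | vertex _, level k => k ≠ 0
  | vertex x, edge e => x ∈ (e : Sym2 W)
  | _, _ => False

/-- The adjacency relation. -/
def adj (A : Set ℕ) (x y : Coding Γ) : Prop := inc A x y ∨ inc A y x

end Coding

/-- The bipartite graph that encodes the graph `Γ` and the set `A`. -/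
abbrev CodingGraph (Γ : SimpleGraph W) (A : Set ℕ) : Type v :=
  BipOf (Coding.adj (Γ := Γ) A) Coding.side

namespace Coding

variable {Γ : SimpleGraph W} {A B : Set ℕ}

theorem side_of_inc {x y : Coding Γ} (h : inc A x y) : side x = true ∧ side y = false := by
  cases x <;> cases y <;> simp_all [inc, side]

theorem isBipWith : IsBipWith (V := CodingGraph Γ A) side := by
  refine BipOf.isBipWith (fun x y h => h.symm) ?_
  rintro x y (h | h) <;> simp [side_of_inc h]

theorem countable [Countable W] : Countable (CodingGraph Γ A) := by
  let f : Coding Γ → (Unit ⊕ Unit ⊕ ℕ ⊕ W) ⊕ (Unit ⊕ ℕ ⊕ Γ.edgeSet)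
    | top => .inl (.inl ())
    | marker => .inl (.inr (.inl ()))
    | point n => .inl (.inr (.inr (.inl n)))
    | vertex x => .inl (.inr (.inr (.inr x)))
    | cotop => .inr (.inl ())
    | level k => .inr (.inr (.inl k))
    | edge e => .inr (.inr (.inr e))
  have : Countable (Sym2 W) := inferInstanceAs (Countable (Quot _))
  have hf : Function.Injective f := by
    rintro (_ | _ | _ | _ | _ | _ | _) (_ | _ | _ | _ | _ | _ | _) h <;> simp_all [f]
  exact hf.countable

/-- `cotop` is adjacent to the whole first part and `top` to the whole second part. -/
theorem hasCommonNeighbours : HasCommonNeighbours (V := CodingGraph Γ A) side := by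
  refine BipOf.hasCommonNeighbours_iff.2 fun b S hS => ?_
  cases b
  · refine ⟨cotop, rfl, fun x hx => Or.inl ?_⟩
    have := hS x hx
    cases x <;> simp_all [inc, side]
  · refine ⟨top, rfl, fun x hx => Or.inr ?_⟩
    have := hS x hx
    cases x <;> simp_all [inc, side]

/-! #### Degrees -/

/-- The set of neighbours of a vertex. -/
def nbhd (A : Set ℕ) (x : Coding Γ) : Set (Coding Γ) := {y | adj A x y}

theorem encard_nbhd_point (n : ℕ) : (nbhd A (point n : Coding Γ)).encard = n + 1 := by
  have h : nbhd A (point n : Coding Γ) = insert cotop (level '' Set.Iio n) := by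
    ext y
    cases y <;> simp [nbhd, adj, inc]
  rw [h, Set.encard_insert_of_notMem (by simp),
    Function.Injective.encard_image (fun a b hab => by simpa using hab),
    Set.encard_eq_coe_toFinset_card]
  simp

theorem encard_eq_top_of_levels {x : Coding Γ} {s : Set ℕ} (hs : s.Infinite)
    (h : ∀ k ∈ s, adj A x (level k)) : (nbhd A x).encard = ⊤ := by
  rw [Set.encard_eq_top_iff]
  refine (hs.image (f := (level : ℕ → Coding Γ)) ?_).mono ?_
  · intro a _ b _ hab
    simpa using hab
  · rintro _ ⟨k, hk, rfl⟩
    exact h k hk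

theorem infinite_code (A : Set ℕ) : (code A).Infinite := by
  refine (Set.infinite_range_of_injective (f := fun n : ℕ => 2 * n) fun a b h => ?_).mono ?_
  · simpa using h
  · rintro _ ⟨n, rfl⟩
    exact Or.inl (by simp)

/-- Within the first part, only the points have finite degree, and their degrees are distinct. -/
theorem eq_point_of_encard {x : Coding Γ} (hx : side x = true) {n : ℕ}
    (h : (nbhd A x).encard = n + 1) : x = point n := by
  have hne : ((n : ℕ∞) + 1) ≠ ⊤ := by exact_mod_cast ENat.natCast_ne_top (n + 1)
  cases x with
  | top =>
    rw [encard_eq_top_of_levels Set.infinite_univ fun k _ => Or.inl (show inc A top (level k) from trivial)] at h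
    exact (hne h.symm).elim
  | marker =>
    rw [encard_eq_top_of_levels (infinite_code A) fun k hk =>
      Or.inl (show inc A marker (level k) from hk)] at h
    exact (hne h.symm).elim
  | point m =>
    rw [encard_nbhd_point] at h
    have : m + 1 = n + 1 := by exact_mod_cast h
    rw [Nat.succ_injective this]
  | vertex x =>
    rw [encard_eq_top_of_levels (Set.finite_singleton 0).infinite_compl
      fun k hk => Or.inl (show inc A (vertex x) (level k) from hk)] at h
    exact (hne h.symm).elim
  | _ => simp [side] at hx

/-- Each vertex of the second part is adjacent to `top` and to something else. As `point 0` has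
degree one, an isomorphism cannot exchange the parts. -/
theorem encard_nbhd_ne_one {x : Coding Γ} (hx : side x = false) : (nbhd A x).encard ≠ 1 := by
  intro h
  rw [Set.encard_eq_one] at h
  obtain ⟨y, hy⟩ := h
  have h1 : ∀ z, adj A x z → z = y := fun z hz => hy.subset hz
  have htop : adj A x top := by
    cases x <;> simp_all [side, adj, inc]
  obtain rfl := h1 _ htop
  cases x with
  | cotop => exact absurd (h1 marker (Or.inr trivial)) (by simp)
  | level k => exact absurd (h1 (point (k + 1)) (Or.inr (Nat.lt_succ_self k))) (by simp)
  | edge e =>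
    obtain ⟨e, he⟩ := e
    induction e with
    | _ a b => exact absurd (h1 (vertex a) (Or.inr (Sym2.mem_mk_left a b))) (by simp)
  | _ => simp [side] at hx

/-! #### Isomorphisms -/

/-- A bijection that preserves adjacency and sides. -/
structure Iso (Γ : SimpleGraph W) (A B : Set ℕ) extends Coding Γ ≃ Coding Γ where
  adj_iff' : ∀ x y, adj B (toFun x) (toFun y) ↔ adj A x y
  side_iff' : ∀ x y, side (toFun x) = side (toFun y) ↔ side x = side y

/-- The inverse of an isomorphism. -/
def Iso.symm (φ : Iso Γ A B) : Iso Γ B A where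
  toEquiv := φ.toEquiv.symm
  adj_iff' x y := by simpa using (φ.adj_iff' (φ.1.symm x) (φ.1.symm y)).symm
  side_iff' x y := by simpa using (φ.side_iff' (φ.1.symm x) (φ.1.symm y)).symm

/-- An isomorphism of the structures, regarded as a bijection of the vertices. -/
def Iso.ofEquiv (φ : CodingGraph Γ A ≃[bipLang] CodingGraph Γ B) : Iso Γ A B where
  toEquiv := φ.toEquiv
  adj_iff' _ _ := BipEquiv.edge_iff φ
  side_iff' _ _ := BipEquiv.part_iff φ

/-- The isomorphism of structures given by a bijection of the vertices. -/
def Iso.toBipEquiv (φ : Iso Γ A B) : CodingGraph Γ A ≃[bipLang] CodingGraph Γ B :=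
  BipEquiv.mk (X := CodingGraph Γ A) (Y := CodingGraph Γ B) φ.toEquiv φ.adj_iff' φ.side_iff'

theorem adj_equiv (φ : Iso Γ A B) (x y : Coding Γ) :
    adj B (φ.1 x) (φ.1 y) ↔ adj A x y := φ.adj_iff' x y

theorem encard_nbhd_equiv (φ : Iso Γ A B) (x : Coding Γ) :
    (nbhd B (φ.1 x)).encard = (nbhd A x).encard := by
  have : nbhd B (φ.1 x) = φ.1 '' nbhd A x := by
    ext y
    constructor
    · intro hy
      obtain ⟨z, rfl⟩ := φ.1.surjective y
      exact ⟨z, (adj_equiv φ x z).1 hy, rfl⟩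
    · rintro ⟨z, hz, rfl⟩
      exact (adj_equiv φ x z).2 hz
  rw [this]
  exact φ.1.injective.encard_image _

theorem side_equiv (φ : Iso Γ A B) (x : Coding Γ) :
    side (φ.1 x) = side x := by
  have h0 : side (φ.1 (point 0)) = true := by
    by_contra h
    rw [Bool.not_eq_true] at h
    apply encard_nbhd_ne_one h
    rw [encard_nbhd_equiv, encard_nbhd_point]
    simp
  have h1 : side (φ.1 x) = side (φ.1 (point 0)) ↔ side x = side (point 0 : Coding Γ) :=
    φ.side_iff' _ _
  rw [h0, show side (point 0 : Coding Γ) = true from rfl] at h1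
  revert h1
  cases side (φ.1 x) <;> cases side x <;> simp

theorem equiv_point (φ : Iso Γ A B) (n : ℕ) :
    φ.1 (point n) = point n :=
  eq_point_of_encard (A := B) (side_equiv φ _)
    (by rw [encard_nbhd_equiv, encard_nbhd_point])

theorem adj_point_equiv (φ : Iso Γ A B) (n : ℕ)
    (x : Coding Γ) : adj B (point n) (φ.1 x) ↔ adj A (point n) x := by
  rw [← adj_equiv φ, equiv_point]

/-- The points are fixed, and the points adjacent to a vertex of the second part reveal its kind:
all of them for `cotop`, those with `n > k` for `level k`, none for an edge. -/
theorem equiv_level (φ : Iso Γ A B) (k : ℕ) :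
    φ.1 (level k) = level k := by
  have hs := side_equiv φ (level k)
  have h := fun n => adj_point_equiv φ n (level k)
  revert hs h
  generalize φ.1 (level k) = y
  intro hs h
  cases y with
  | cotop =>
    have := h 0
    simp [adj, inc] at this
  | level j =>
    have h' : ∀ n, j < n ↔ k < n := fun n => by simpa [adj, inc] using h n
    have h1 := h' (k + 1)
    have h2 := h' (j + 1)
    rw [show j = k by omega]
  | edge e =>
    have := h (k + 1)
    simp [adj, inc] at this
  | _ => simp [side] at hs

theorem equiv_cotop (φ : Iso Γ A B) : φ.1 cotop = cotop := by
  have hs := side_equiv φ cotop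
  have h := adj_point_equiv φ 0 cotop
  revert hs h
  generalize φ.1 cotop = y
  intro hs h
  cases y <;> simp_all [adj, inc, side]

theorem exists_equiv_edge (φ : Iso Γ A B) (e : Γ.edgeSet) :
    ∃ e' : Γ.edgeSet, φ.1 (edge e) = edge e' := by
  have hs := side_equiv φ (edge e)
  have h := fun n => adj_point_equiv φ n (edge e)
  revert hs h
  generalize φ.1 (edge e) = y
  intro hs h
  cases y with
  | cotop =>
    have := h 0
    simp [adj, inc] at this
  | level j =>
    have := h (j + 1)
    simp [adj, inc] at this
  | edge e' => exact ⟨e', rfl⟩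
  | _ => simp [side] at hs

theorem adj_level_equiv (φ : Iso Γ A B) (k : ℕ)
    (x : Coding Γ) : adj B (φ.1 x) (level k) ↔ adj A x (level k) := by
  rw [← adj_equiv φ, equiv_level]

theorem equiv_ne_point (φ : Iso Γ A B) {x : Coding Γ}
    (hx : ∀ n, x ≠ point n) (n : ℕ) : φ.1 x ≠ point n := fun h =>
  hx n (φ.1.injective (h.trans (equiv_point φ n).symm))

/-- With the levels fixed, adjacency to levels 0 and 1 separates the non-points of the first part:
`top` sees both, `marker` only 0, each `vertex x` only 1. -/
theorem equiv_top (φ : Iso Γ A B) : φ.1 top = top := by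
  have hs := side_equiv φ top
  have h0 := adj_level_equiv φ 0 top
  have h1 := adj_level_equiv φ 1 top
  have hp := equiv_ne_point φ (x := top) (by simp)
  revert hs h0 h1 hp
  generalize φ.1 top = y
  intro hs h0 h1 hp
  cases y <;> simp_all [adj, inc, side, one_notMem_code]

theorem equiv_marker (φ : Iso Γ A B) : φ.1 marker = marker := by
  have hs := side_equiv φ marker
  have h0 := adj_level_equiv φ 0 marker
  have h1 := adj_level_equiv φ 1 marker
  have hp := equiv_ne_point φ (x := marker) (by simp)
  revert hs h0 h1 hp
  generalize φ.1 marker = y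
  intro hs h0 h1 hp
  cases y <;> simp_all [adj, inc, side, one_notMem_code]

theorem exists_equiv_vertex (φ : Iso Γ A B) (x : W) :
    ∃ x' : W, φ.1 (vertex x) = vertex x' := by
  have hs := side_equiv φ (vertex x)
  have h0 := adj_level_equiv φ 0 (vertex x)
  have h1 := adj_level_equiv φ 1 (vertex x)
  have hp := equiv_ne_point φ (x := vertex x) (by simp)
  revert hs h0 h1 hp
  generalize φ.1 (vertex x) = y
  intro hs h0 h1 hp
  cases y <;> simp_all [adj, inc, side, zero_mem_code]

/-- The set `A` can be recovered from the graph that encodes it. -/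
theorem eq_of_equiv (ψ : CodingGraph Γ A ≃[bipLang] CodingGraph Γ B) : A = B := by
  let φ := Iso.ofEquiv ψ
  apply code_injective
  ext k
  have := adj_level_equiv φ k marker
  rw [equiv_marker] at this
  simpa [adj, inc] using this.symm

/-- The map on vertices induced by a graph automorphism. -/
def mapFun (g : Γ ≃g Γ) : Coding Γ → Coding Γ
  | top => top
  | marker => marker
  | point n => point n
  | vertex x => vertex (g x)
  | cotop => cotop
  | level k => level k
  | edge e => edge ⟨Sym2.map g e, by
      obtain ⟨e, he⟩ := e
      induction e with
      | _ a b => exact g.map_adj_iff.2 he⟩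

theorem mapFun_mul (g h : Γ ≃g Γ) (x : Coding Γ) :
    mapFun (g * h) x = mapFun g (mapFun h x) := by
  cases x with
  | edge e =>
    obtain ⟨e, he⟩ := e
    induction e with
    | _ a b => rfl
  | _ => rfl

theorem mapFun_one (x : Coding Γ) : mapFun (1 : Γ ≃g Γ) x = x := by
  cases x with
  | edge e =>
    obtain ⟨e, he⟩ := e
    induction e with
    | _ a b => rfl
  | _ => rfl

theorem side_mapFun (g : Γ ≃g Γ) (x : Coding Γ) : side (mapFun g x) = side x := by
  cases x <;> rfl

theorem inc_mapFun (g : Γ ≃g Γ) (x y : Coding Γ) :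
    inc A (mapFun g x) (mapFun g y) ↔ inc A x y := by
  cases x <;> cases y <;> try exact Iff.rfl
  rename_i x e
  change g x ∈ Sym2.map g e ↔ x ∈ (e : Sym2 W)
  rw [Sym2.mem_map]
  exact ⟨fun ⟨z, hz, h⟩ => g.injective h ▸ hz, fun h => ⟨x, h, rfl⟩⟩

/-- The bijection induced by a graph automorphism. -/
def mapIso (A : Set ℕ) (g : Γ ≃g Γ) : Iso Γ A A where
  toFun := mapFun g
  invFun := mapFun g⁻¹
  left_inv x := by rw [← mapFun_mul, inv_mul_cancel, mapFun_one]
  right_inv x := by rw [← mapFun_mul, mul_inv_cancel, mapFun_one]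
  adj_iff' x y := or_congr (inc_mapFun g x y) (inc_mapFun g y x)
  side_iff' x y := by rw [side_mapFun, side_mapFun]

/-- The automorphism induced by a graph automorphism. -/
def mapEquiv (A : Set ℕ) (g : Γ ≃g Γ) : CodingGraph Γ A ≃[bipLang] CodingGraph Γ A :=
  (mapIso A g).toBipEquiv

theorem mapEquiv_injective : Function.Injective (mapEquiv (Γ := Γ) A) := by
  intro g h hgh
  refine DFunLike.ext _ _ fun x => ?_
  have : mapFun g (vertex x) = mapFun h (vertex x) := DFunLike.congr_fun hgh (vertex x)
  simpa [mapFun] using this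

/-- The image of an edge vertex is an edge vertex incident with `g x` and `g y`; these are distinct,
so they are its two ends. -/
theorem adj_of_equiv (φ : Iso Γ A B) {g : W → W}
    (hg : ∀ x, φ.1 (vertex x) = vertex (g x)) {x y : W} (h : Γ.Adj x y) :
    Γ.Adj (g x) (g y) ∧ ∀ e : Γ.edgeSet, (e : Sym2 W) = s(x, y) →
      ∃ e' : Γ.edgeSet, φ.1 (edge e) = edge e' ∧ (e' : Sym2 W) = s(g x, g y) := by
  have key : ∀ e : Γ.edgeSet, (e : Sym2 W) = s(x, y) →
      ∃ e' : Γ.edgeSet, φ.1 (edge e) = edge e' ∧ (e' : Sym2 W) = s(g x, g y) := by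
    intro e he
    obtain ⟨e', he'⟩ := exists_equiv_edge φ e
    have hmem : ∀ z, g z ∈ (e' : Sym2 W) ↔ z ∈ (e : Sym2 W) := fun z => by
      have := adj_equiv φ (vertex z) (edge e)
      rw [hg, he'] at this
      simpa [adj, inc] using this
    have hne : g x ≠ g y := fun hxy => h.ne (by
      have := φ.1.injective ((hg x).trans ((congrArg vertex hxy).trans (hg y).symm))
      simpa using this)
    refine ⟨e', he', (Sym2.mem_and_mem_iff hne).1 ⟨?_, ?_⟩⟩
    · rw [hmem, he]; exact Sym2.mem_mk_left x y
    · rw [hmem, he]; exact Sym2.mem_mk_right x y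
  obtain ⟨e', -, he'⟩ := key ⟨s(x, y), h⟩ rfl
  refine ⟨?_, key⟩
  rw [← SimpleGraph.mem_edgeSet, ← he']
  exact e'.2

/-- An automorphism fixes everything except the `vertex` and `edge` vertices; it permutes the former
by an automorphism of `Γ`, and the latter follow their ends. -/
theorem mapEquiv_surjective : Function.Surjective (mapEquiv (Γ := Γ) A) := by
  intro φ
  let φ' := Iso.ofEquiv φ
  choose g hg using exists_equiv_vertex φ'
  choose g' hg' using exists_equiv_vertex φ'.symm
  have h1 : ∀ x, g' (g x) = x := fun x => by
    have := φ'.1.symm_apply_apply (vertex x)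
    rw [hg] at this; change φ'.symm.1 _ = _ at this; rw [hg'] at this
    simpa using this
  have h2 : ∀ x, g (g' x) = x := fun x => by
    have := φ'.1.apply_symm_apply (vertex x)
    change φ'.1 (φ'.symm.1 _) = _ at this; rw [hg', hg] at this
    simpa using this
  let γ : Γ ≃g Γ := ⟨⟨g, g', h1, h2⟩, fun {x y} =>
    ⟨fun h => by simpa [h1] using (adj_of_equiv φ'.symm hg' h).1,
      fun h => (adj_of_equiv φ' hg h).1⟩⟩
  refine ⟨γ, DFunLike.ext _ _ fun x => ?_⟩
  change mapFun γ x = φ'.1 x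
  change Coding Γ at x
  cases x with
  | top => exact (equiv_top φ').symm
  | marker => exact (equiv_marker φ').symm
  | point n => exact (equiv_point φ' n).symm
  | vertex x => exact (hg x).symm
  | cotop => exact (equiv_cotop φ').symm
  | level k => exact (equiv_level φ' k).symm
  | edge e =>
    obtain ⟨e, he⟩ := e
    induction e with
    | _ a b =>
      obtain ⟨e', h3, h4⟩ := (adj_of_equiv φ' hg he).2 ⟨s(a, b), he⟩ rfl
      rw [h3]
      exact congrArg edge (Subtype.ext h4.symm)

end Coding

end

/-! ### The Fraïssé limit is itself bipartite -/

section

variable {V : Type u} [bipLang.Structure V]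

/-- The age controls only finite substructures, but three vertices suffice: two to compare, and a
base vertex against which sides are measured. -/
theorem IsCountableUniversalBipartiteGraph.exists_isBipWith_triple [Countable V]
    (hV : IsCountableUniversalBipartiteGraph V) (x y z : V) :
    ∃ q : Fin 3 → Bool, ∀ i j, (BipPart (![x, y, z] i) (![x, y, z] j) ↔ q i = q j) ∧
      (BipEdge (![x, y, z] i) (![x, y, z] j) → BipEdge (![x, y, z] j) (![x, y, z] i)) ∧
      (BipEdge (![x, y, z] i) (![x, y, z] j) → q i ≠ q j) := by
  let T : bipLang.Substructure V := ⟨Set.range ![x, y, z], fun c => Empty.elim c⟩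
  have hT : Finite T := inferInstanceAs (Finite (Set.range ![x, y, z]))
  have hmem : CategoryTheory.Bundled.of (c := bipLang.Structure) T ∈
      Language.age bipLang V :=
    Language.age.fg_substructure (Language.Substructure.fg_iff_finite.2 hT)
  rw [hV.age] at hmem
  obtain ⟨q, hq⟩ := IsBipartiteGraph.exists_isBipWith hmem.2
  let t : Fin 3 → T := fun i => ⟨![x, y, z] i, i, rfl⟩
  have hP : ∀ i j, BipPart (t i) (t j) ↔ BipPart (![x, y, z] i) (![x, y, z] j) := fun i j =>
    (BipEmb.part_iff T.subtype).symm
  have hE : ∀ i j, BipEdge (t i) (t j) ↔ BipEdge (![x, y, z] i) (![x, y, z] j) := fun i j =>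
    (BipEmb.edge_iff T.subtype).symm
  refine ⟨fun i => q (t i), fun i j => ?_⟩
  rw [← hP, ← hE, ← hE]
  exact ⟨hq.part_iff _ _, hq.symm _ _, hq.edge_ne _ _⟩

theorem IsCountableUniversalBipartiteGraph.exists_isBipWith [Countable V]
    (hV : IsCountableUniversalBipartiteGraph V) : ∃ p : V → Bool, IsBipWith p := by
  classical
  rcases isEmpty_or_nonempty V with h | ⟨⟨a⟩⟩
  · exact ⟨fun _ => true, fun x => isEmptyElim x, fun x => isEmptyElim x,
      fun x => isEmptyElim x⟩
  have key : ∀ x y : V, BipPart x y ↔ (BipPart x a ↔ BipPart y a) := fun x y => by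
    obtain ⟨q, hq⟩ := hV.exists_isBipWith_triple x y a
    have h1 := (hq 0 1).1
    have h2 := (hq 0 2).1
    have h3 := (hq 1 2).1
    simp only [Matrix.cons_val] at h1 h2 h3
    rw [h1, h2, h3]
    cases q 0 <;> cases q 1 <;> cases q 2 <;> simp
  refine ⟨fun x => decide (BipPart x a), fun x y => ?_, fun x y h => ?_, fun x y h => ?_⟩
  · rw [key, decide_eq_decide]
  · obtain ⟨q, hq⟩ := hV.exists_isBipWith_triple x y a
    exact (hq 0 1).2.1 h
  · obtain ⟨q, hq⟩ := hV.exists_isBipWith_triple x y a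
    rw [Ne, decide_eq_decide, ← key]
    exact fun h' => (hq 0 1).2.2 h ((hq 0 1).1.1 h')

end

section

variable {V : Type u} [bipLang.Structure V]

/-! ### The main theorem -/

/-- A D-class is determined by a representative, which bounds the number from above. From below, the
retracts `CodingGraph Γ A` for different `A` are not isomorphic, so their D-classes differ. -/
theorem mk_isRegularDClass_eq_continuum [Countable V] {p : V → Bool} (hp : IsBipWith p)
    (hV : HasExtension p) {W : Type v} [Countable W] (Γ : SimpleGraph W) :
    Cardinal.mk {D : Set (BipEnd V) // IsRegularDClass D ∧
      (∃ H : Set (BipEnd V), IsGroupHClass H ∧ H ⊆ D) ∧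
      ∀ H : Set (BipEnd V), IsGroupHClass H → H ⊆ D → IsIsoToGroup H (Γ ≃g Γ)} =
        Cardinal.continuum := by
  apply le_antisymm
  · have h : ∀ D : {D : Set (BipEnd V) // IsRegularDClass D ∧
        (∃ H : Set (BipEnd V), IsGroupHClass H ∧ H ⊆ D) ∧
        ∀ H : Set (BipEnd V), IsGroupHClass H → H ⊆ D → IsIsoToGroup H (Γ ≃g Γ)},
        ∃ f, D.1 = dClass f := fun ⟨D, ⟨f, _, hD⟩, _⟩ => ⟨f, hD⟩
    choose f hf using h
    refine (Cardinal.mk_le_of_injective (f := f) fun D D' h => ?_).trans mk_bipEnd_le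
    exact Subtype.ext (by rw [hf, hf, h])
  · have h : ∀ A : Set ℕ, ∃ e : BipEnd V, SplitsThrough e (CodingGraph Γ A) := fun A =>
      have : Countable (CodingGraph Γ A) := Coding.countable
      exists_splitsThrough hp hV Coding.isBipWith Coding.hasCommonNeighbours
    choose e he using h
    have hD : ∀ A, IsRegularDClass (dClass (e A)) ∧
        (∃ H : Set (BipEnd V), IsGroupHClass H ∧ H ⊆ dClass (e A)) ∧
        ∀ H : Set (BipEnd V), IsGroupHClass H → H ⊆ dClass (e A) →
          IsIsoToGroup H (Γ ≃g Γ) := fun A => by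
      have hid := (he A).isIdempotentElem
      refine ⟨⟨e A, ⟨e A, by rw [hid.eq, hid.eq]⟩, rfl⟩, ⟨hClass (e A),
        isGroupHClass_hClass hid, hClass_subset_dClass.2 (mem_dClass_self _)⟩, ?_⟩
      intro H hH hHD
      obtain ⟨f, hf, rfl⟩ := hH.exists_idempotent
      refine (((he A).mem_dClass_iff hf).1 (hClass_subset_dClass.1 hHD)).isIsoToGroup
        (Coding.mapEquiv A) ⟨Coding.mapEquiv_injective, Coding.mapEquiv_surjective⟩ ?_
      exact fun g h x => Coding.mapFun_mul g h x
    have hinj : Function.Injective fun A : Set ℕ =>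
        (⟨dClass (e A), hD A⟩ : {D : Set (BipEnd V) // IsRegularDClass D ∧
          (∃ H : Set (BipEnd V), IsGroupHClass H ∧ H ⊆ D) ∧
          ∀ H : Set (BipEnd V), IsGroupHClass H → H ⊆ D → IsIsoToGroup H (Γ ≃g Γ)}) := by
      intro A A' h
      have hmem : e A' ∈ dClass (e A) := (Subtype.mk.inj h).symm ▸ mem_dClass_self (e A')
      obtain ⟨φ⟩ := (((he A).mem_dClass_iff (he A').isIdempotentElem).1 hmem).nonempty_equiv
        (he A')
      exact Coding.eq_of_equiv φ
    have := Cardinal.lift_mk_le_lift_mk_of_injective hinj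
    rwa [Cardinal.mk_set_nat, Cardinal.lift_continuum, Cardinal.lift_id'] at this

end

theorem mainTheorem9 {B : Type u} [bipLang.Structure B] [Countable B]
    (hB : IsCountableUniversalBipartiteGraph B) :
    (∀ {W : Type v} [Countable W] (Γ : SimpleGraph W),
      Cardinal.mk {D : Set (BipEnd B) // IsRegularDClass D ∧
        (∃ H : Set (BipEnd B), IsGroupHClass H ∧ H ⊆ D) ∧
        ∀ H : Set (BipEnd B), IsGroupHClass H → H ⊆ D → IsIsoToGroup H (Γ ≃g Γ)} =
          Cardinal.continuum) ∧
    (∀ f : BipEnd B, IsIdempotentElem f → ¬ ImageIsoK11 f →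
      Cardinal.mk {H : Set (BipEnd B) // IsGroupHClass H ∧ H ⊆ dClass f} =
        Cardinal.continuum) ∧
    (∃ D : Set (BipEnd B), IsDClass D ∧
      (∀ f : BipEnd B, IsIdempotentElem f → (f ∈ D ↔ ImageIsoK11 f)) ∧
      Cardinal.mk {H : Set (BipEnd B) // IsGroupHClass H ∧ H ⊆ D} = Cardinal.aleph0 ∧
      ∀ H : Set (BipEnd B), IsGroupHClass H → H ⊆ D →
        IsIsoToGroup H (Multiplicative (ZMod 2))) := by
  obtain ⟨p, hp⟩ := hB.exists_isBipWith
  have hV := hB.hasExtension hp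
  refine ⟨fun Γ => mk_isRegularDClass_eq_continuum hp hV Γ,
    fun f hf hK => mk_groupHClass_eq_continuum hp hV hf hK, ?_⟩
  have hmk := mk_splitsThrough_completeBip hp hV
  obtain ⟨e, he⟩ : ∃ e : BipEnd B, SplitsThrough e (CompleteBip Unit Unit) := by
    by_contra! h
    have : IsEmpty {e : BipEnd B // SplitsThrough e (CompleteBip Unit Unit)} :=
      ⟨fun e => h e.1 e.2⟩
    rw [Cardinal.mk_eq_zero] at hmk
    exact Cardinal.aleph0_ne_zero hmk.symm
  refine ⟨dClass e, ⟨e, rfl⟩, fun f hf => (he.mem_dClass_iff hf).trans hf.imageIsoK11_iff.symm,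
    ?_, fun H hH hHD => ?_⟩
  · rw [← Cardinal.mk_congr (groupHClassEquiv e), ← hmk]
    exact Cardinal.mk_congr (Equiv.subtypeEquivRight fun f =>
      ⟨fun h => (he.mem_dClass_iff h.1).1 h.2,
        fun h => ⟨h.isIdempotentElem, (he.mem_dClass_iff h.isIdempotentElem).2 h⟩⟩)
  · obtain ⟨f, hf, rfl⟩ := hH.exists_idempotent
    exact ((he.mem_dClass_iff hf).1 (hClass_subset_dClass.1 hHD)).isIsoToGroup_completeBip
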